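/- Let $(H,W,\mu)$ be an abstract Wiener space: $H$ is a separable real Hilbert space, continuously and densely embedded in the real Banach space $W$, and $\mu$ is the Borel probability measure on $W$ with $\int_W e^{i\langle w,\varphi\rangle}\,d\mu(w)=e^{-|\varphi|_H^2/2}$ for all $\varphi\in W^*\subset H$. For $h\in H$ let $\langle\cdot,h\rangle=\delta^1(h)\in L^2(W,\mu)$ denote the continuous extension from $W^*$ to $H$ of $\varphi\mapsto\langle\cdot,\varphi\rangle$, and let $\mathcal E(h)=\exp\{\langle\cdot,h\rangle-|h|_H^2/2\}$. For an element $T$ of the symmetric Hilbert tensor power $H^{\hat\otimes k}$ let $\delta^k(T)$ be its multiple Wiener–Itô integral, i.e. $\delta^k$ is the continuous linear extension of $h^{\otimes k}\mapsto|h|_H^k\,\mathrm{He}_k(\langle\cdot,h\rangle/|h|_H)$ with $\mathrm{He}_k$ the $k$-th probabilists' Hermite polynomial. Every $f\in L^2(W,\mu)$ has a unique chaos decomposition $f=\sum_{k\ge0}\delta^k(f_k)$, $f_k\in H^{\hat\otimes k}$, converging in $L^2(W,\mu)$; $f_1\in H$ is its first kernel. For $f=\sum_k\delta^k(f_k)$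 and $g=\sum_j\delta^j(g_j)$ in $L^2(W,\mu)$, the Wick product $f\diamond g$ is the (generalized) random variable with chaos expansion $\sum_{n\ge0}\delta^n\big(\sum_{k+j=n}f_k\hat\otimes g_j\big)$. A function $u\in L^p(W,\mu)$ with $p>1$ is said to equal $f\diamond g$ if $\int_W u\,\delta^n(h^{\otimes n})\,d\mu=n!\,\big\langle\sum_{k+j=n}f_k\hat\otimes g_j,\,h^{\otimes n}\big\rangle$ for all $n\ge0$ and $h\in H$. Let $X$ be a random variable with values in $W$ whose law is absolutely continuous with respect to $\mu$ with a density $f\in L^2(W,\mu)$. Then: 1. The expectation $E[X]$, i.e. the unique element of $W$ such that $E[\langle X,\varphi\rangle]=\langle E[X],\varphi\rangle$ for all $\varphi\in W^*$ (with $\langle X,\varphi\rangle$ integrable), exists, belongs to $H$, and coincides with the first kernel $f_1$ of the chaos decomposition of $f$. 2. The Wick product $f\diamond\mathcal E(-E[X])$ is a function, belonging to $L^p(W,\mu)$ for some $p>1$, and it is the density of the law of $X-E[X]$ with respect to $\mu$. -/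

import Mathlib

open MeasureTheory ProbabilityTheory
open scoped ENNReal

noncomputable section

namespace WienerChaos

variable {H W Ω : Type*} [NormedAddCommGroup H] [InnerProductSpace ℝ H] [CompleteSpace H]
  [NormedAddCommGroup W] [NormedSpace ℝ W] [MeasurableSpace W] [MeasurableSpace Ω]

/-! ### Abstract Wiener spaces and the first-order integral -/

/-- The embedding of the dual `W*` into `H`: `φ` is sent to the vector `dualEmb i φ` of `H` with
`⟪dualEmb i φ, h⟫ = φ (i h)` for all `h`. -/
def dualEmb (i : H →L[ℝ] W) : StrongDual ℝ W →ₗ[ℝ] H where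
  toFun φ := (InnerProductSpace.toDual ℝ H).symm (φ.comp i)
  map_add' φ ψ := by rw [ContinuousLinearMap.add_comp, map_add]
  map_smul' c φ := by
    rw [ContinuousLinearMap.smul_comp, LinearIsometryEquiv.map_smulₛₗ]; rfl

/-- `(H, W, μ)` is an abstract Wiener space: `i` embeds the Hilbert space `H` continuously, injectively
and densely into the Banach space `W`, and `μ` is the probability measure on `W` with
characteristic functional `φ ↦ exp (-‖φ‖_H² / 2)` on `W*`. (Separability of `H` and completeness
of `H` and `W` are type class assumptions of the theorem.) -/
structure IsAbstractWienerSpace (i : H →L[ℝ] W) (μ : Measure W) : Prop where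
  injective : Function.Injective i
  denseRange : DenseRange i
  isProbabilityMeasure : IsProbabilityMeasure μ
  charFunDual_eq : ∀ φ : StrongDual ℝ W,
    charFunDual μ φ = Complex.exp (-(((‖dualEmb i φ‖ ^ 2 / 2 : ℝ)) : ℂ))

/-- The map `h ↦ ⟨·, h⟩ = δ¹(h)`, from `H` to `L²(μ)`: the continuous extension to `H` of the map
that sends `φ ∈ W* ⊆ H` to the class of the function `w ↦ φ w`. -/
def wienerIntegral (i : H →L[ℝ] W) (μ : Measure W) : H →L[ℝ] Lp ℝ 2 μ :=
  (StrongDual.toLpₗ (𝕜 := ℝ) μ 2).extendOfNorm (dualEmb i)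

/-- The stochastic exponential `ℰ(h) = exp (⟨·, h⟩ - |h|² / 2)`. -/
def stochExp (i : H →L[ℝ] W) (μ : Measure W) (h : H) (w : W) : ℝ :=
  Real.exp (wienerIntegral i μ h w - ‖h‖ ^ 2 / 2)

/-! ### Symmetric tensors

The Hilbert tensor power `H^{⊗k}` is realized as the space of Hilbert-Schmidt `k`-linear forms
`T` on `H`, where `T (h₁, …, h_k)` is the inner product of `T` with `h₁ ⊗ ⋯ ⊗ h_k`. -/

/-- `T` is an element of the symmetric Hilbert tensor power of order `k` of `H`: it is symmetric, and
the sums of the squares of its coefficients along finite orthonormal families are bounded. -/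
structure IsKernel {k : ℕ} (T : H [×k]→L[ℝ] ℝ) : Prop where
  symm : ∀ (σ : Equiv.Perm (Fin k)) (v : Fin k → H), T (v ∘ σ) = T v
  hilbertSchmidt : ∃ C : ℝ, ∀ (n : ℕ) (e : Fin n → H), Orthonormal ℝ e →
    ∑ s : Fin k → Fin n, T (e ∘ s) ^ 2 ≤ C

/-- The tensor product: `(T ⊗ S) (h₁, …, h_{k+j}) = T (h₁, …, h_k) * S (h_{k+1}, …, h_{k+j})`. -/
def tensor {k j : ℕ} (T : H [×k]→L[ℝ] ℝ) (S : H [×j]→L[ℝ] ℝ) : H [×(k + j)]→L[ℝ] ℝ :=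
  ((T.smulRight S).uncurrySum).domDomCongr finSumFinEquiv

/-- Symmetrization of a tensor: the average over all permutations of the arguments. -/
def symmetrize {n : ℕ} (T : H [×n]→L[ℝ] ℝ) : H [×n]→L[ℝ] ℝ :=
  ((n.factorial : ℝ)⁻¹) • ∑ σ : Equiv.Perm (Fin n), T.domDomCongr σ

/-- The kernels of the formal Wick product of two chaos series: the kernel of order `n` is
`∑_{k+j=n} F_k ⊗̂ G_j`, where `⊗̂` is the symmetrized tensor product. This is the bilinear
extension of the rule `δ^k(F_k) ⋄ δ^j(G_j) = δ^{k+j}(F_k ⊗̂ G_j)`. -/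
def wickKernel (F G : ∀ k : ℕ, H [×k]→L[ℝ] ℝ) (n : ℕ) : H [×n]→L[ℝ] ℝ :=
  ∑ q ∈ (Finset.HasAntidiagonal.antidiagonal n).attach,
    (symmetrize (tensor (F q.1.1) (G q.1.2))).domDomCongr
      (finCongr (Finset.HasAntidiagonal.mem_antidiagonal.1 q.2))

/-! ### Multiple integrals and chaos decompositions -/

/-- The multiple Wiener-Itô integral `δ^k(h^{⊗k}) = |h|^k He_k(⟨·, h⟩ / |h|)`, with `He_k` the
(probabilists') Hermite polynomial. For `h = 0` this is `1` if `k = 0` and `0` otherwise. -/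
def hermitePower (i : H →L[ℝ] W) (μ : Measure W) (k : ℕ) (h : H) (w : W) : ℝ :=
  ‖h‖ ^ k * Polynomial.aeval (wienerIntegral i μ h w / ‖h‖) (Polynomial.hermite k)

/-- The Wiener chaos of order `k`: the closed linear span in `L²(μ)` of the `δ^k(h^{⊗k})`. -/
def chaos (i : H →L[ℝ] W) (μ : Measure W) (k : ℕ) : Submodule ℝ (Lp ℝ 2 μ) :=
  (Submodule.span ℝ {u : Lp ℝ 2 μ | ∃ h : H, u =ᵐ[μ] hermitePower i μ k h}).topologicalClosure

/-- `u = δ^k(T)`, the multiple Wiener-Itô integral of `T`. The map `δ^k` is the continuous linear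
extension of `h^{⊗k} ↦ hermitePower i μ k h` to the symmetric tensors, and it is `√(k!)` times an
isometry onto the Wiener chaos of order `k`; so `δ^k(T)` is the one element of this chaos whose
inner product with every `δ^k(h^{⊗k})` is `k! ⟨T, h^{⊗k}⟩`. -/
structure IsMultipleIntegral (i : H →L[ℝ] W) (μ : Measure W) {k : ℕ} (T : H [×k]→L[ℝ] ℝ)
    (u : Lp ℝ 2 μ) : Prop where
  mem_chaos : u ∈ chaos i μ k
  integral_mul : ∀ h : H,
    ∫ w, u w * hermitePower i μ k h w ∂μ = (k.factorial : ℝ) * T (fun _ => h)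

/-- `f ∈ L²(μ)` has the chaos decomposition `f = ∑_k δ^k(F_k)`, a series that converges in `L²(μ)`,
with kernels `F_k` in the symmetric tensor powers of `H`. -/
def HasChaosDecomposition (i : H →L[ℝ] W) (μ : Measure W) (f : W → ℝ)
    (F : ∀ k : ℕ, H [×k]→L[ℝ] ℝ) : Prop :=
  ∃ hf : MemLp f 2 μ, ∃ I : ℕ → Lp ℝ 2 μ,
    (∀ k, IsKernel (F k) ∧ IsMultipleIntegral i μ (F k) (I k)) ∧ HasSum I (hf.toLp f)

/-- `u` is the function with the (generalized) chaos expansion `∑_n δ^n(U_n)`. The Wick product of two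
elements of `L²(μ)` need not lie in `L²(μ)`, and the chaos series of a function in `L^p(μ)` with
`1 < p < 2` need not converge in norm; the expansion is then understood, as is usual for
generalized random variables, by pairing with the test variables `δ^n(h^{⊗n})`. For `p > 1` the
pairings are integrals of integrable functions and determine `u` almost everywhere. -/
def HasGeneralizedChaosExpansion (i : H →L[ℝ] W) (μ : Measure W) (u : W → ℝ)
    (U : ∀ n : ℕ, H [×n]→L[ℝ] ℝ) : Prop :=
  (∃ p : ℝ≥0∞, 1 < p ∧ MemLp u p μ) ∧
    ∀ (n : ℕ) (h : H),
      ∫ w, u w * hermitePower i μ n h w ∂μ = (n.factorial : ℝ) * U n (fun _ => h)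

/-- `u` is the Wick product `f ⋄ g` of `f, g ∈ L²(μ)`: if `f = ∑ δ^k(F_k)` and `g = ∑ δ^j(G_j)`, then
`u` has the chaos expansion `∑_n δ^n(∑_{k+j=n} F_k ⊗̂ G_j)`. -/
def IsWickProduct (i : H →L[ℝ] W) (μ : Measure W) (f g u : W → ℝ) : Prop :=
  ∃ F G : ∀ k : ℕ, H [×k]→L[ℝ] ℝ, HasChaosDecomposition i μ f F ∧
    HasChaosDecomposition i μ g G ∧ HasGeneralizedChaosExpansion i μ u (wickKernel F G)

/-! ### Densities and expectations of `W`-valued random variables -/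

/-- `u` is a (version of the) density with respect to `μ` of the law of the random variable `Y`. -/
def HasDensity (P : Measure Ω) (Y : Ω → W) (μ : Measure W) (u : W → ℝ) : Prop :=
  0 ≤ᵐ[μ] u ∧ AEMeasurable u μ ∧ HasLaw Y (μ.withDensity fun w => ENNReal.ofReal (u w)) P

/-- `m ∈ W` is the expectation `E[Y]` of the `W`-valued random variable `Y`: for every `φ ∈ W*`, the real
random variable `φ(Y)` is integrable and has expectation `φ m`. -/
def IsExpectation (P : Measure Ω) (Y : Ω → W) (m : W) : Prop :=
  ∀ φ : StrongDual ℝ W, Integrable (fun ω => φ (Y ω)) P ∧ ∫ ω, φ (Y ω) ∂P = φ m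

end WienerChaos

end

noncomputable section

/-! ### Hermite polynomials under the standard Gaussian law -/

section

namespace WienerChaos

open Polynomial

/-! Let `m` be the Riesz representative of `h ↦ ∫ f ⟨·,h⟩ dμ`. Testing against `φ ∈ W*` shows that
`i m` is the expectation of `X`, and since `He_1(x) = x` the same functional is the first kernel of
`f`.

By Cameron–Martin (`map_add_eq_tiltedMeasure`), translation by `i m` carries `ℰ(-m) μ` to `μ`, so `X
- i m` has density `u(w) = f(w + i m) ℰ(-m)(w)`. Hölder puts `u` in `L^{4/3}`. To see that `u` is
the Wick product, pair it with `δ^n(h^{⊗n})` and translate back: the pairing is the integral of `f`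
against the Hermite power with argument shifted by `-⟨h,m⟩`. The binomial rule `hermiteR_eval_add`
splits it into the pairings of `f` with lower Hermite powers times powers of `-⟨h,m⟩`, which are the
pairings of `ℰ(-m)`. This is `n!` times the Wick kernel on the diagonal
(`integral_shiftedDensity_mul_hermitePower`).

Every other candidate for the Wick product agrees with `u` because a function in `L^p`, `p > 1`, is
determined by its pairings with Hermite powers (`ae_eq_zero_of_integral_hermitePower_eq_zero`):
vanishing pairings give vanishing polynomial, then exponential moments along every direction, so the
positive and negative parts have the same one-dimensional images. Two further uses of this circle of
ideas, orthogonality of Hermite powers and totality of the chaoses, give the chaos decomposition;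
its kernels come from polarization, and a Bessel argument shows that they are Hilbert–Schmidt. -/

lemma integrable_eval_gaussianReal (p : ℝ[X]) (m : ℝ) (v : NNReal) :
    Integrable (fun x => p.eval x) (gaussianReal m v) := by
  induction p using Polynomial.induction_on' with
  | add p q hp hq => simp only [eval_add]; exact hp.add hq
  | monomial n a =>
    simp only [eval_monomial]
    refine Integrable.const_mul ?_ a
    have := (memLp_id_gaussianReal (μ := m) (v := v) n).integrable_norm_pow'
    refine (integrable_norm_iff (by fun_prop)).1 ?_
    simpa using this

/-- Gaussian integration by parts for polynomials. -/
lemma integral_mul_eval_gaussianReal (p : ℝ[X]) :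
    ∫ x, x * p.eval x ∂(gaussianReal 0 1) = ∫ x, (derivative p).eval x ∂(gaussianReal 0 1) := by
  have key (q : ℝ[X]) : Integrable (fun x => q.eval x * gaussianPDFReal 0 1 x) := by
    have := integrable_eval_gaussianReal q 0 1
    rw [gaussianReal_of_var_ne_zero _ one_ne_zero] at this
    rw [integrable_withDensity_iff (measurable_gaussianPDF 0 1)
      (ae_of_all _ fun _ => gaussianPDF_lt_top)] at this
    simpa only [toReal_gaussianPDF] using this
  have hd (x : ℝ) : HasDerivAt (gaussianPDFReal 0 1) (-x * gaussianPDFReal 0 1 x) x := by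
    unfold gaussianPDFReal
    have h1 : HasDerivAt (fun x : ℝ => -(x - 0) ^ 2 / (2 * ((1 : NNReal) : ℝ))) (-x) x := by
      have := (((hasDerivAt_id x).sub_const 0).pow 2).neg.div_const (2 * ((1 : NNReal) : ℝ))
      convert! this using 1
      simp
      ring
    convert! (h1.exp).const_mul (√(2 * Real.pi * ((1 : NNReal) : ℝ)))⁻¹ using 1
    ring
  have := integral_mul_deriv_eq_deriv_mul_of_integrable
    (u := fun x => p.eval x) (u' := fun x => (derivative p).eval x) (v := gaussianPDFReal 0 1)
    (v' := fun x => -x * gaussianPDFReal 0 1 x) (fun x _ => p.hasDerivAt x) (fun x _ => hd x)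
    (by
      refine (key (-(X * p))).congr (ae_of_all _ fun x => ?_)
      simp; ring) (key _) (key _)
  rw [integral_gaussianReal_eq_integral_smul one_ne_zero,
    integral_gaussianReal_eq_integral_smul one_ne_zero]
  simp only [smul_eq_mul]
  have h2 : ∫ x, p.eval x * (-x * gaussianPDFReal 0 1 x) = -∫ x, gaussianPDFReal 0 1 x * (x * p.eval x) := by
    rw [← integral_neg]; congr with x; ring
  rw [h2] at this
  rw [neg_inj.1 this]
  congr with x; ring

/-- The Hermite polynomial with real coefficients. -/
abbrev hermiteR (k : ℕ) : ℝ[X] := (hermite k).map (Int.castRingHom ℝ)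

lemma aeval_hermite (k : ℕ) (x : ℝ) : aeval x (hermite k) = (hermiteR k).eval x := by
  rw [eval_map, aeval_def]; rfl

lemma hermiteR_succ (k : ℕ) : hermiteR (k + 1) = X * hermiteR k - derivative (hermiteR k) := by
  simp [hermiteR, hermite_succ, derivative_map]

lemma derivative_hermiteR (k : ℕ) :
    derivative (hermiteR (k + 1)) = C ((k : ℝ) + 1) * hermiteR k := by
  induction k with
  | zero => simp [hermiteR]
  | succ k ih =>
    rw [hermiteR_succ (k + 1), derivative_sub, derivative_mul, ih, derivative_mul, hermiteR_succ k]
    simp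
    ring

/-- By integration by parts, `q ↦ x q - q'` is the Gaussian adjoint of differentiation, and
`hermiteR k` is its `k`-th iterate applied to `1`. -/
lemma integral_hermiteR_mul_eval (k : ℕ) (q : ℝ[X]) :
    ∫ x, (hermiteR k).eval x * q.eval x ∂(gaussianReal 0 1)
      = ∫ x, (derivative^[k] q).eval x ∂(gaussianReal 0 1) := by
  induction k generalizing q with
  | zero => simp [hermiteR]
  | succ k ih =>
    rw [Function.iterate_succ_apply, ← ih, hermiteR_succ]
    have h1 := integral_mul_eval_gaussianReal (hermiteR k * q)
    have e1 : ∫ x, x * (hermiteR k * q).eval x ∂(gaussianReal 0 1)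
        = ∫ x, (X * hermiteR k * q).eval x ∂(gaussianReal 0 1) := by
      congr with x; simp; ring
    rw [e1] at h1
    have h2 : ∀ x, (X * hermiteR k - derivative (hermiteR k)).eval x * q.eval x
        = (X * hermiteR k * q).eval x - (derivative (hermiteR k) * q).eval x := by
      intro x; simp; ring
    simp_rw [h2]
    rw [integral_sub (integrable_eval_gaussianReal _ _ _) (integrable_eval_gaussianReal _ _ _), h1,
      ← integral_sub (integrable_eval_gaussianReal _ _ _) (integrable_eval_gaussianReal _ _ _)]
    congr with x
    simp [derivative_mul]

lemma integral_hermiteR_mul_hermiteR (k j : ℕ) :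
    ∫ x, (hermiteR k).eval x * (hermiteR j).eval x ∂(gaussianReal 0 1)
      = if k = j then (k.factorial : ℝ) else 0 := by
  wlog h : j ≤ k generalizing k j
  · have := this j k (by omega)
    simp_rw [mul_comm] at this ⊢
    rw [this, if_neg (by omega), if_neg (by omega)]
  have hdeg : (hermiteR j).natDegree = j := by
    rw [hermiteR, (hermite_monic j).natDegree_map]; exact natDegree_hermite
  -- All derivatives are moved onto the polynomial of lower degree `j ≤ k`: the result is `k!` if `j
  -- = k` and `0` if `j < k`.
  rw [integral_hermiteR_mul_eval]
  split_ifs with hkj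
  · subst hkj
    have : derivative^[k] (hermiteR k) = C (k.factorial : ℝ) := by
      have h0 : (derivative^[k] (hermiteR k)).natDegree ≤ 0 := by
        have := natDegree_iterate_derivative (hermiteR k) k
        omega
      rw [eq_C_of_natDegree_le_zero h0, coeff_iterate_derivative]
      simp [hermiteR, Nat.descFactorial_self, coeff_hermite_self]
    simp [this]
  · rw [iterate_derivative_eq_zero (by omega)]
    simp

/-- In the recursion at `x + c`, the `x` term and the derivative term cancel by integration by
parts, so each step contributes one factor `c`. -/
lemma integral_hermiteR_add (k : ℕ) (c : ℝ) :
    ∫ x, (hermiteR k).eval (x + c) ∂(gaussianReal 0 1) = c ^ k := by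
  induction k with
  | zero => simp [hermiteR]
  | succ k ih =>
    have h1 := integral_mul_eval_gaussianReal ((hermiteR k).comp (X + C c))
    have e (x : ℝ) : (hermiteR (k + 1)).eval (x + c) = (X * (hermiteR k).comp (X + C c)).eval x
        + (C c * (hermiteR k).comp (X + C c)).eval x
        - (derivative ((hermiteR k).comp (X + C c))).eval x := by
      rw [hermiteR_succ]
      simp [derivative_comp]
      ring
    simp_rw [e]
    rw [integral_sub (f := fun x => _ + _)
      ((integrable_eval_gaussianReal _ _ _).add (integrable_eval_gaussianReal _ _ _))
      (integrable_eval_gaussianReal _ _ _),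
      integral_add (integrable_eval_gaussianReal _ _ _) (integrable_eval_gaussianReal _ _ _), ← h1]
    simp only [eval_mul, eval_X, eval_C, integral_const_mul, eval_comp, eval_add, ih]
    ring

/-- Taylor expansion at `x`: Hermite polynomials form an Appell sequence, so the Taylor coefficients
are binomial multiples of lower Hermite polynomials. -/
lemma hermiteR_eval_add (n : ℕ) (x y : ℝ) :
    (hermiteR n).eval (x + y)
      = ∑ q ∈ Finset.HasAntidiagonal.antidiagonal n, (n.choose q.1 : ℝ) * (hermiteR q.1).eval x * y ^ q.2 := by
  -- For `j > n` the truncated `n - j` is harmless, since the descending factorial vanishes.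
  have hd (j : ℕ) : ∀ n, derivative^[j] (hermiteR n) = C (n.descFactorial j : ℝ) * hermiteR (n - j) := by
    induction j with
    | zero => simp
    | succ j ih =>
      intro n
      rw [Function.iterate_succ_apply]
      cases n with
      | zero => simp [hermiteR]
      | succ n =>
        rw [derivative_hermiteR, iterate_derivative_C_mul, ih, ← mul_assoc, ← C_mul,
          Nat.succ_descFactorial_succ]
        simp
  have hT : (hermiteR n).eval (x + y)
      = ∑ j ∈ Finset.range (n + 1), ((n.choose j : ℝ) * (hermiteR (n - j)).eval x) * y ^ j := by
    have hdeg : (taylor x (hermiteR n)).natDegree < n + 1 := by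
      rw [natDegree_taylor, hermiteR, (hermite_monic n).natDegree_map, natDegree_hermite]; omega
    rw [add_comm x y, ← taylor_eval, eval_eq_sum_range' hdeg]
    refine Finset.sum_congr rfl fun j hj => ?_
    rw [taylor_coeff]
    congr 1
    have h2 := congrArg (eval x) (hd j n)
    have h3 := congrArg (eval x) (congrFun (factorial_smul_hasseDeriv (R := ℝ) j) (hermiteR n))
    rw [h2] at h3
    simp only [nsmul_eq_mul, eval_mul, eval_C] at h3
    have h4 : (n.descFactorial j : ℝ) = j.factorial * n.choose j := by
      exact_mod_cast Nat.descFactorial_eq_factorial_mul_choose n j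
    rw [h4, mul_assoc] at h3
    have h5 : (j.factorial : ℝ) ≠ 0 := by positivity
    apply mul_left_cancel₀ h5
    simpa using h3
  rw [hT, Finset.Nat.sum_antidiagonal_eq_sum_range_succ
    (fun a b => (n.choose a : ℝ) * (hermiteR a).eval x * y ^ b), ← Finset.sum_range_reflect]
  refine Finset.sum_congr rfl fun j hj => ?_
  have hj' : j ≤ n := by simp at hj; omega
  have e1 : n + 1 - 1 - j = n - j := by omega
  have e2 : n - (n - j) = j := by omega
  rw [e1, e2, Nat.choose_symm hj']

end WienerChaos

end

/-! ### Functions determined by exponential moments -/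

section

namespace WienerChaos

section Determination

variable {α : Type*} [MeasurableSpace α] {μ : Measure α} {v Y : α → ℝ}

lemma integral_withDensity_ofReal (hv : AEMeasurable v μ) (g : α → ℝ) :
    ∫ a, g a ∂(μ.withDensity fun a => ENNReal.ofReal (v a)) = ∫ a, max (v a) 0 * g a ∂μ := by
  rw [integral_withDensity_eq_integral_toReal_smul₀ hv.ennreal_ofReal (by simp)]
  simp [ENNReal.toReal_ofReal']

lemma integrable_withDensity_ofReal (hv : AEMeasurable v μ) {g : α → ℝ}
    (hg : AEStronglyMeasurable g μ) (h : Integrable (fun a => v a * g a) μ) :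
    Integrable g (μ.withDensity fun a => ENNReal.ofReal (v a)) := by
  rw [integrable_withDensity_iff_integrable_smul₀' hv.ennreal_ofReal (by simp)]
  refine h.mono (hv.ennreal_ofReal.ennreal_toReal.aestronglyMeasurable.smul hg) (ae_of_all _ fun a => ?_)
  simp only [smul_eq_mul, ENNReal.toReal_ofReal', norm_mul]
  gcongr
  rw [Real.norm_eq_abs, Real.norm_eq_abs, abs_of_nonneg (le_max_right _ _)]
  exact max_le (le_abs_self _) (abs_nonneg _)

lemma integral_withDensity_ofReal_sub (hv : AEMeasurable v μ) {g : α → ℝ}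
    (hg : AEStronglyMeasurable g μ) (h : Integrable (fun a => v a * g a) μ) :
    ∫ a, g a ∂(μ.withDensity fun a => ENNReal.ofReal (v a))
      - ∫ a, g a ∂(μ.withDensity fun a => ENNReal.ofReal (-v a)) = ∫ a, v a * g a ∂μ := by
  have h1 := integrable_withDensity_ofReal hv hg h
  have h2 := integrable_withDensity_ofReal (v := fun a => -v a) hv.neg hg (by simpa using h.neg)
  rw [integrable_withDensity_iff_integrable_smul₀' (by fun_prop) (by simp)] at h1 h2
  simp only [smul_eq_mul, ENNReal.toReal_ofReal'] at h1 h2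
  rw [integral_withDensity_ofReal hv, integral_withDensity_ofReal (v := fun a => -v a) hv.neg,
    ← integral_sub h1 h2]
  congr with a
  rw [← sub_mul]
  congr 1
  rcases le_total (v a) 0 with h | h
  · rw [max_eq_right h, max_eq_left (by linarith)]; ring
  · rw [max_eq_left h, max_eq_right (by linarith)]; ring

/-- If all exponential moments of `Y` with respect to the signed measure `v μ` vanish, then the
images of the positive and negative parts of `v μ` under `Y` coincide. -/
lemma map_withDensity_eq_of_integral_exp_eq_zero (hY : AEMeasurable Y μ)
    (hint : ∀ t : ℝ, Integrable (fun a => v a * Real.exp (t * Y a)) μ)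
    (h0 : ∀ t : ℝ, ∫ a, v a * Real.exp (t * Y a) ∂μ = 0) :
    (μ.withDensity fun a => ENNReal.ofReal (v a)).map Y
      = (μ.withDensity fun a => ENNReal.ofReal (-v a)).map Y := by
  have hv : Integrable v μ := by simpa using hint 0
  have hvm := hv.aestronglyMeasurable.aemeasurable
  set ν₁ := μ.withDensity fun a => ENNReal.ofReal (v a)
  set ν₂ := μ.withDensity fun a => ENNReal.ofReal (-v a)
  have i1 : IsFiniteMeasure ν₁ := isFiniteMeasure_withDensity_ofReal hv.2
  have i2 : IsFiniteMeasure ν₂ := isFiniteMeasure_withDensity_ofReal hv.neg.2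
  have hYe (t : ℝ) : AEStronglyMeasurable (fun a => Real.exp (t * Y a)) μ := by fun_prop
  have e1 : integrableExpSet Y ν₁ = Set.univ := Set.eq_univ_of_forall fun t =>
    integrable_withDensity_ofReal hvm (hYe t) (hint t)
  have hm : mgf Y ν₁ = mgf Y ν₂ := by
    funext t
    have := integral_withDensity_ofReal_sub hvm (hYe t) (hint t)
    rw [h0 t, sub_eq_zero] at this
    exact this
  -- The value of the mgf at `0` is the total mass. Analytic continuation to the complex mgf needs
  -- the two measures to vanish together.
  have hz : ν₁ = 0 ↔ ν₂ = 0 := by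
    have := congrFun hm 0
    rw [mgf_zero', mgf_zero'] at this
    rw [← Measure.measure_univ_eq_zero, ← Measure.measure_univ_eq_zero,
      ← measureReal_eq_zero_iff, ← measureReal_eq_zero_iff, this]
  refine Measure.ext_of_complexMGF_eq (hY.mono_ac (withDensity_absolutelyContinuous _ _))
    (hY.mono_ac (withDensity_absolutelyContinuous _ _)) ?_
  funext z
  exact eqOn_complexMGF_of_mgf' hm hz (by simp [e1])

lemma integral_mul_comp_eq_zero_of_integral_exp_eq_zero (hY : AEMeasurable Y μ)
    (hint : ∀ t : ℝ, Integrable (fun a => v a * Real.exp (t * Y a)) μ)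
    (h0 : ∀ t : ℝ, ∫ a, v a * Real.exp (t * Y a) ∂μ = 0) {g : ℝ → ℝ} (hg : Measurable g)
    (hvg : Integrable (fun a => v a * g (Y a)) μ) :
    ∫ a, v a * g (Y a) ∂μ = 0 := by
  have hv : Integrable v μ := by simpa using hint 0
  have hvm := hv.aestronglyMeasurable.aemeasurable
  have key := map_withDensity_eq_of_integral_exp_eq_zero hY hint h0
  rw [← integral_withDensity_ofReal_sub (g := fun a => g (Y a)) hvm
    (hg.comp_aemeasurable hY).aestronglyMeasurable hvg, sub_eq_zero]
  have h := congrArg (fun ν => ∫ x, g x ∂ν) key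
  rwa [integral_map (hY.mono_ac (withDensity_absolutelyContinuous _ _))
      hg.aestronglyMeasurable, integral_map (hY.mono_ac (withDensity_absolutelyContinuous _ _))
      hg.aestronglyMeasurable] at h

/-- The exponential series is integrated term by term, dominated by `|v| exp |tY| ≤ |v| (exp (tY) +
exp (-tY))`. -/
lemma integral_exp_eq_zero_of_integral_pow_eq_zero (hY : AEMeasurable Y μ)
    (hint : ∀ t : ℝ, Integrable (fun a => v a * Real.exp (t * Y a)) μ)
    (h0 : ∀ n : ℕ, ∫ a, v a * Y a ^ n ∂μ = 0) (t : ℝ) :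
    ∫ a, v a * Real.exp (t * Y a) ∂μ = 0 := by
  have hv : Integrable v μ := by simpa using hint 0
  have hexp (x : ℝ) : HasSum (fun n : ℕ => x ^ n / n.factorial) (Real.exp x) := by
    rw [Real.exp_eq_exp_ℝ]; exact NormedSpace.expSeries_div_hasSum_exp x
  have hb : Integrable (fun a => |v a| * Real.exp |t * Y a|) μ := by
    refine ((hint t).norm.add (hint (-t)).norm).mono' (by
      have := hv.aestronglyMeasurable; fun_prop) (ae_of_all _ fun a => ?_)
    simp only [norm_mul, Real.norm_eq_abs, Pi.add_apply, abs_abs, Real.abs_exp, ← mul_add]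
    gcongr
    rcases abs_cases (t * Y a) with h | h
    · rw [h.1]; linarith [Real.exp_pos (-t * Y a)]
    · rw [h.1, neg_mul]; linarith [Real.exp_pos (t * Y a)]
  have := hasSum_integral_of_dominated_convergence (μ := μ)
    (F := fun (n : ℕ) a => v a * ((t * Y a) ^ n / n.factorial))
    (f := fun a => v a * Real.exp (t * Y a))
    (fun n a => |v a| * (|t * Y a| ^ n / n.factorial))
    (fun n => by have := hv.aestronglyMeasurable; fun_prop)
    (fun n => ae_of_all _ fun a => by simp)
    (ae_of_all _ fun a => ((hexp _).summable).mul_left _)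
    (by
      refine hb.congr (ae_of_all _ fun a => ?_)
      simp only
      rw [tsum_mul_left, (hexp _).tsum_eq])
    (ae_of_all _ fun a => (hexp _).mul_left _)
  refine this.unique ?_
  convert hasSum_zero with n
  have e (a : α) : v a * ((t * Y a) ^ n / n.factorial) = (t ^ n / n.factorial) * (v a * Y a ^ n) := by
    rw [mul_pow]; ring
  simp_rw [e]
  rw [integral_const_mul, h0, mul_zero]

end Determination

variable {H W : Type*} [NormedAddCommGroup H] [InnerProductSpace ℝ H] [CompleteSpace H]
  [NormedAddCommGroup W] [NormedSpace ℝ W] [MeasurableSpace W] [BorelSpace W]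
  {i : H →L[ℝ] W} {μ : Measure W}

/-- Applied to all multiples `t • φ`, the one-dimensional result equates the images under `φ` of the
positive and negative parts of `v μ`. Characteristic functionals then identify these two measures,
so both parts of `v` vanish. -/
lemma ae_eq_zero_of_integral_exp_dual_eq_zero [CompleteSpace W] [SecondCountableTopology W]
    {v : W → ℝ}
    (hint : ∀ φ : StrongDual ℝ W, Integrable (fun w => v w * Real.exp (φ w)) μ)
    (h0 : ∀ φ : StrongDual ℝ W, ∫ w, v w * Real.exp (φ w) ∂μ = 0) :
    v =ᵐ[μ] 0 := by
  have hv : Integrable v μ := by simpa using hint 0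
  have hvm := hv.aestronglyMeasurable.aemeasurable
  have i1 : IsFiniteMeasure (μ.withDensity fun a => ENNReal.ofReal (v a)) :=
    isFiniteMeasure_withDensity_ofReal hv.2
  have i2 : IsFiniteMeasure (μ.withDensity fun a => ENNReal.ofReal (-v a)) :=
    isFiniteMeasure_withDensity_ofReal hv.neg.2
  have key : (μ.withDensity fun a => ENNReal.ofReal (v a))
      = (μ.withDensity fun a => ENNReal.ofReal (-v a)) := by
    refine Measure.ext_of_charFunDual ?_
    ext φ
    rw [charFunDual_eq_charFun_map_one, charFunDual_eq_charFun_map_one,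
      map_withDensity_eq_of_integral_exp_eq_zero (by fun_prop)
        (fun t => by simpa using hint (t • φ)) (fun t => by simpa using h0 (t • φ))]
  rw [withDensity_eq_iff (by fun_prop) (by fun_prop) hv.lintegral_lt_top.ne] at key
  filter_upwards [key] with w hw
  rcases le_total (v w) 0 with h | h
  · rw [ENNReal.ofReal_of_nonpos h, eq_comm, ENNReal.ofReal_eq_zero] at hw
    simp; linarith
  · rw [ENNReal.ofReal_of_nonpos (p := -v w) (by linarith), ENNReal.ofReal_eq_zero] at hw
    simp; linarith

end WienerChaos

end

/-! ### The Wiener integral as an isonormal Gaussian family -/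

section

namespace WienerChaos

/-- The map is 1-Lipschitz: `|e^{iu} - e^{iv}| ≤ |u - v|`, and `L¹` norms are at most `L²` norms. It
carries characteristic functions from `W*` to its closure. -/
lemma continuous_integral_cexp {α : Type*} [MeasurableSpace α] (μ : Measure α) [IsProbabilityMeasure μ] :
    Continuous fun u : Lp ℝ 2 μ => ∫ w, Complex.exp (u w * Complex.I) ∂μ := by
  refine (LipschitzWith.of_dist_le_mul (K := 1) fun u v => ?_).continuous
  have hu := (Lp.aestronglyMeasurable u)
  have hv := (Lp.aestronglyMeasurable v)
  have hi (u : Lp ℝ 2 μ) : Integrable (fun w => Complex.exp (u w * Complex.I)) μ := by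
    have hu := (Lp.aestronglyMeasurable u).aemeasurable
    refine (integrable_const (1 : ℝ)).mono' (by fun_prop) (ae_of_all _ fun w => ?_)
    rw [Complex.norm_exp_ofReal_mul_I]
  have huv : Integrable (fun w => ‖u w - v w‖) μ :=
    (((Lp.memLp u).sub (Lp.memLp v)).integrable (by norm_num)).norm
  rw [dist_eq_norm, dist_eq_norm, ← integral_sub (hi u) (hi v), NNReal.coe_one, one_mul]
  calc _ ≤ ∫ w, ‖u w - v w‖ ∂μ := by
        refine norm_integral_le_of_norm_le huv (ae_of_all _ fun w => ?_)
        have e : Complex.exp (u w * Complex.I) - Complex.exp (v w * Complex.I)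
            = Complex.exp (v w * Complex.I)
              * (Complex.exp (Complex.I * ((u w - v w : ℝ) : ℂ)) - 1) := by
          rw [mul_sub, ← Complex.exp_add]
          push_cast
          ring_nf
        rw [e, norm_mul, Complex.norm_exp_ofReal_mul_I, one_mul]
        exact Real.norm_exp_I_mul_ofReal_sub_one_le
    _ = (eLpNorm (fun w => u w - v w) 1 μ).toReal := by
        rw [eLpNorm_one_eq_lintegral_enorm]
        exact integral_norm_eq_lintegral_enorm (hu.sub hv)
    _ ≤ (eLpNorm (fun w => u w - v w) 2 μ).toReal :=
        ENNReal.toReal_mono ((Lp.memLp u).sub (Lp.memLp v)).2.ne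
          (eLpNorm_le_eLpNorm_of_exponent_le (by norm_num) (hu.sub hv))
    _ = ‖u - v‖ := by
        rw [Lp.norm_def, eLpNorm_congr_ae (Lp.coeFn_sub u v)]
        rfl

variable {H W : Type*} [NormedAddCommGroup H] [InnerProductSpace ℝ H] [CompleteSpace H]
  [NormedAddCommGroup W] [NormedSpace ℝ W]
  {i : H →L[ℝ] W}

open scoped InnerProductSpace

lemma inner_dualEmb (i : H →L[ℝ] W) (φ : StrongDual ℝ W) (h : H) :
    ⟪dualEmb i φ, h⟫_ℝ = φ (i h) := by
  simp [dualEmb]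

/-- A vector orthogonal to the range is sent by `i` to a point killed by all of `W*`, hence is zero.
-/
lemma denseRange_dualEmb (hi : Function.Injective i) : DenseRange (dualEmb i) := by
  have : (LinearMap.range (dualEmb i)).topologicalClosure = ⊤ := by
    rw [Submodule.topologicalClosure_eq_top_iff, Submodule.eq_bot_iff]
    intro h hh
    rw [Submodule.mem_orthogonal] at hh
    apply hi
    rw [map_zero]
    refine SeparatingDual.eq_zero_of_forall_dual_eq_zero (R := ℝ) fun φ => ?_
    rw [← inner_dualEmb]
    exact hh _ ⟨φ, rfl⟩
  rwa [← Submodule.dense_iff_topologicalClosure_eq_top] at this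

variable [MeasurableSpace W] [BorelSpace W] {μ : Measure W}

lemma IsAbstractWienerSpace.map_dual_eq (hμ : IsAbstractWienerSpace i μ) (φ : StrongDual ℝ W) :
    μ.map φ = gaussianReal 0 (‖dualEmb i φ‖₊ ^ 2) := by
  have := hμ.isProbabilityMeasure
  have : IsProbabilityMeasure (μ.map φ) := Measure.isProbabilityMeasure_map (by fun_prop)
  refine Measure.ext_of_charFun ?_
  ext t
  rw [charFun_map_eq_charFunDual_smul, hμ.charFunDual_eq, charFun_gaussianReal, map_smul, norm_smul]
  congr 1
  push_cast
  simp [mul_pow, ← Complex.ofReal_pow]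
  ring

lemma IsAbstractWienerSpace.isGaussian (hμ : IsAbstractWienerSpace i μ) : IsGaussian μ :=
  isGaussian_of_map_eq_gaussianReal fun φ => ⟨_, _, hμ.map_dual_eq φ⟩

variable [CompleteSpace W] [SecondCountableTopology W]

lemma IsAbstractWienerSpace.memLp_id (hμ : IsAbstractWienerSpace i μ) : MemLp id 2 μ := by
  have := hμ.isGaussian
  exact IsGaussian.memLp_two_id

/-- The squared `L²` norm is the variance of the Gaussian law of `φ`. This isometry is what makes
`extendOfNorm` a genuine extension in `wienerIntegral`. -/
lemma IsAbstractWienerSpace.norm_toLpₗ (hμ : IsAbstractWienerSpace i μ) (φ : StrongDual ℝ W) :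
    ‖StrongDual.toLpₗ (𝕜 := ℝ) μ 2 φ‖ = ‖dualEmb i φ‖ := by
  rw [StrongDual.toLpₗ_apply hμ.memLp_id, Lp.norm_toLp,
    ← Function.id_comp (⇑φ), ← eLpNorm_map_measure (by fun_prop) (by fun_prop), hμ.map_dual_eq]
  have h := variance_id_gaussianReal (μ := 0) (v := ‖dualEmb i φ‖₊ ^ 2)
  rw [variance_of_integral_eq_zero (by fun_prop) (by simp)] at h
  have h2 := (memLp_id_gaussianReal (μ := 0) (v := ‖dualEmb i φ‖₊ ^ 2) 2)
  have h3 := h2.eLpNorm_eq_integral_rpow_norm (by simp) (by simp)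
  simp only [id_eq, NNReal.coe_pow, coe_nnnorm] at h
  simp only [ENNReal.coe_ofNat, ENNReal.toReal_ofNat, Real.rpow_ofNat, id_eq, Real.norm_eq_abs,
    sq_abs, h] at h3
  rw [h3, ENNReal.toReal_ofReal (by positivity), ← Real.rpow_natCast, ← Real.rpow_mul (norm_nonneg _)]
  norm_num

lemma IsAbstractWienerSpace.wienerIntegral_dualEmb (hμ : IsAbstractWienerSpace i μ)
    (φ : StrongDual ℝ W) : wienerIntegral i μ (dualEmb i φ) =ᵐ[μ] φ := by
  rw [wienerIntegral, LinearMap.extendOfNorm_eq (denseRange_dualEmb hμ.injective)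
    ⟨1, fun φ => by rw [hμ.norm_toLpₗ, one_mul]⟩, StrongDual.toLpₗ_apply hμ.memLp_id]
  exact MemLp.coeFn_toLp _

lemma IsAbstractWienerSpace.map_wienerIntegral (hμ : IsAbstractWienerSpace i μ) (h : H) :
    μ.map (wienerIntegral i μ h) = gaussianReal 0 (‖h‖₊ ^ 2) := by
  have := hμ.isProbabilityMeasure
  have hm (h : H) : AEMeasurable (wienerIntegral i μ h) μ :=
    (Lp.aestronglyMeasurable _).aemeasurable
  have : IsProbabilityMeasure (μ.map (wienerIntegral i μ h)) :=
    Measure.isProbabilityMeasure_map (hm h)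
  have key (h : H) : ∫ w, Complex.exp (wienerIntegral i μ h w * Complex.I) ∂μ
      = Complex.exp (-((‖h‖ ^ 2 / 2 : ℝ) : ℂ)) := by
    refine (denseRange_dualEmb hμ.injective).induction_on h (isClosed_eq
      ((continuous_integral_cexp μ).comp (wienerIntegral i μ).continuous) (by fun_prop)) fun φ => ?_
    rw [← hμ.charFunDual_eq, charFunDual_apply]
    refine integral_congr_ae ?_
    filter_upwards [hμ.wienerIntegral_dualEmb φ] with w hw
    rw [hw]
  refine Measure.ext_of_charFun ?_
  ext t
  rw [charFun_apply_real, integral_map (hm h) (by fun_prop), charFun_gaussianReal]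
  have e : ∫ w, Complex.exp (t * wienerIntegral i μ h w * Complex.I) ∂μ
      = ∫ w, Complex.exp (wienerIntegral i μ (t • h) w * Complex.I) ∂μ := by
    refine integral_congr_ae ?_
    have := Lp.coeFn_smul t (wienerIntegral i μ h)
    rw [← map_smul] at this
    filter_upwards [this] with w hw
    rw [hw]; simp
  rw [e, key, norm_smul]
  congr 1
  push_cast
  simp [mul_pow, ← Complex.ofReal_pow]
  ring

end WienerChaos

end

/-! ### Exponential tilting and the Cameron–Martin theorem -/

section

namespace WienerChaos

open scoped InnerProductSpace

lemma memLp_exp_of_forall_integrable {α : Type*} [MeasurableSpace α] {μ : Measure α} {Y : α → ℝ}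
    (hY : AEMeasurable Y μ) (h : ∀ t : ℝ, Integrable (fun a => Real.exp (t * Y a)) μ) {p : ℝ≥0∞}
    (hp : p ≠ ∞) : MemLp (fun a => Real.exp (Y a)) p μ := by
  rcases eq_or_ne p 0 with rfl | hp0
  · rw [memLp_zero_iff_aestronglyMeasurable]; fun_prop
  · rw [← integrable_norm_rpow_iff (by fun_prop) hp0 hp]
    refine (h p.toReal).congr (ae_of_all _ fun a => ?_)
    simp only [Real.norm_eq_abs, Real.abs_exp, ← Real.exp_mul, mul_comm]

lemma memLp_eval_of_forall_integrable_exp {α : Type*} [MeasurableSpace α] {μ : Measure α}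
    {Y : α → ℝ} (hY : AEMeasurable Y μ)
    (h : ∀ t : ℝ, Integrable (fun a => Real.exp (t * Y a)) μ) {p : ℝ≥0∞} (hp : p ≠ ∞)
    (q : Polynomial ℝ) : MemLp (fun a => q.eval (Y a)) p μ := by
  induction q using Polynomial.induction_on' with
  | add q r hq hr => simp only [Polynomial.eval_add]; exact hq.add hr
  | monomial n c =>
    simp only [Polynomial.eval_monomial]
    refine MemLp.const_mul ?_ c
    have h1 := memLp_exp_of_forall_integrable hY h hp
    have h2 := memLp_exp_of_forall_integrable (Y := fun a => -Y a) hY.neg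
      (fun t => by simpa using h (-t)) hp
    refine ((h1.add h2).const_mul (n.factorial : ℝ)).mono' (by fun_prop) (ae_of_all _ fun a => ?_)
    have h3 := Real.pow_div_factorial_le_exp _ (abs_nonneg (Y a)) n
    rw [div_le_iff₀ (by positivity)] at h3
    rw [norm_pow, Real.norm_eq_abs, mul_comm]
    refine h3.trans ?_
    gcongr
    simp only [Pi.add_apply]
    rcases abs_cases (Y a) with h | h
    · rw [h.1]; linarith [Real.exp_pos (-Y a)]
    · rw [h.1]; linarith [Real.exp_pos (Y a)]

lemma integral_gaussianReal_eq_integral_affine (c s : ℝ) (hs : 0 ≤ s) {g : ℝ → ℝ}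
    (hg : Measurable g) :
    ∫ x, g x ∂(gaussianReal c (s.toNNReal ^ 2)) = ∫ x, g (s * x + c) ∂(gaussianReal 0 1) := by
  have : gaussianReal c (s.toNNReal ^ 2) = (gaussianReal 0 1).map (fun x => s * x + c) := by
    rw [← Function.comp_def (fun x => x + c) (fun x => s * x), ← Measure.map_map (by fun_prop)
      (by fun_prop), gaussianReal_map_const_mul, gaussianReal_map_add_const]
    congr 1
    · simp
    · ext; simp [hs]
  rw [this, integral_map (by fun_prop) hg.aestronglyMeasurable]

variable {H W : Type*} [NormedAddCommGroup H] [InnerProductSpace ℝ H] [CompleteSpace H]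
  [NormedAddCommGroup W] [NormedSpace ℝ W] [MeasurableSpace W] {i : H →L[ℝ] W} {μ : Measure W}

lemma aemeasurable_wienerIntegral (i : H →L[ℝ] W) (μ : Measure W) (h : H) :
    AEMeasurable (wienerIntegral i μ h) μ := (Lp.aestronglyMeasurable _).aemeasurable

lemma aemeasurable_stochExp (i : H →L[ℝ] W) (μ : Measure W) (h : H) :
    AEMeasurable (stochExp i μ h) μ := by
  have := aemeasurable_wienerIntegral i μ h
  unfold stochExp; fun_prop

lemma wienerIntegral_smul_ae (i : H →L[ℝ] W) (μ : Measure W) (t : ℝ) (h : H) :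
    wienerIntegral i μ (t • h) =ᵐ[μ] fun w => t * wienerIntegral i μ h w := by
  rw [map_smul]; exact Lp.coeFn_smul t (wienerIntegral i μ h)

lemma wienerIntegral_add_ae (i : H →L[ℝ] W) (μ : Measure W) (h g : H) :
    wienerIntegral i μ (h + g) =ᵐ[μ] fun w => wienerIntegral i μ h w + wienerIntegral i μ g w := by
  rw [map_add]; exact Lp.coeFn_add _ _

lemma hermitePower_eq (i : H →L[ℝ] W) (μ : Measure W) (k : ℕ) (h : H) (w : W) :
    hermitePower i μ k h w
      = (Polynomial.C (‖h‖ ^ k) * (hermiteR k).comp (Polynomial.C ‖h‖⁻¹ * Polynomial.X)).eval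
        (wienerIntegral i μ h w) := by
  rw [hermitePower, aeval_hermite]
  simp [div_eq_inv_mul]

lemma stochExp_pos (i : H →L[ℝ] W) (μ : Measure W) (h : H) (w : W) : 0 < stochExp i μ h w :=
  Real.exp_pos _

/-- The measure with density `ℰ(h)` with respect to `μ`. -/
def tiltedMeasure (i : H →L[ℝ] W) (μ : Measure W) (h : H) : Measure W :=
  μ.withDensity fun w => ENNReal.ofReal (stochExp i μ h w)

lemma integral_tiltedMeasure (i : H →L[ℝ] W) (μ : Measure W) (h : H) (g : W → ℝ) :
    ∫ w, g w ∂(tiltedMeasure i μ h) = ∫ w, stochExp i μ h w * g w ∂μ := by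
  rw [tiltedMeasure, integral_withDensity_ofReal (aemeasurable_stochExp i μ h)]
  congr with w
  rw [max_eq_left (stochExp_pos i μ h w).le]

lemma tiltedMeasure_absolutelyContinuous (i : H →L[ℝ] W) (μ : Measure W) (h : H) :
    tiltedMeasure i μ h ≪ μ := withDensity_absolutelyContinuous _ _

variable [BorelSpace W] [CompleteSpace W] [SecondCountableTopology W]

namespace IsAbstractWienerSpace

lemma integrable_exp (hμ : IsAbstractWienerSpace i μ) (h : H) (t : ℝ) :
    Integrable (fun w => Real.exp (t * wienerIntegral i μ h w)) μ := by
  have := hμ.isProbabilityMeasure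
  have h1 := mgf_gaussianReal (hμ.map_wienerIntegral h) t
  -- A non-integrable function has Bochner integral `0` by convention, so a positive mgf value
  -- proves integrability.
  refine Integrable.of_integral_ne_zero ?_
  rw [mgf] at h1
  rw [h1]
  positivity

lemma integral_exp (hμ : IsAbstractWienerSpace i μ) (h : H) :
    ∫ w, Real.exp (wienerIntegral i μ h w) ∂μ = Real.exp (‖h‖ ^ 2 / 2) := by
  have := mgf_gaussianReal (hμ.map_wienerIntegral h) 1
  simpa [mgf] using this

lemma memLp_exp (hμ : IsAbstractWienerSpace i μ) (h : H) {p : ℝ≥0∞} (hp : p ≠ ∞) :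
    MemLp (fun w => Real.exp (wienerIntegral i μ h w)) p μ :=
  memLp_exp_of_forall_integrable (aemeasurable_wienerIntegral i μ h) (hμ.integrable_exp h) hp

lemma memLp_eval (hμ : IsAbstractWienerSpace i μ) (h : H) (q : Polynomial ℝ) {p : ℝ≥0∞}
    (hp : p ≠ ∞) : MemLp (fun w => q.eval (wienerIntegral i μ h w)) p μ :=
  memLp_eval_of_forall_integrable_exp (aemeasurable_wienerIntegral i μ h) (hμ.integrable_exp h) hp q

lemma memLp_hermitePower (hμ : IsAbstractWienerSpace i μ) (k : ℕ) (h : H) {p : ℝ≥0∞}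
    (hp : p ≠ ∞) : MemLp (hermitePower i μ k h) p μ := by
  simp only [funext (hermitePower_eq i μ k h)]
  exact hμ.memLp_eval h _ hp

lemma memLp_stochExp (hμ : IsAbstractWienerSpace i μ) (h : H) {p : ℝ≥0∞}
    (hp : p ≠ ∞) : MemLp (stochExp i μ h) p μ := by
  refine ((hμ.memLp_exp h hp).const_mul (Real.exp (-(‖h‖ ^ 2 / 2)))).ae_eq (ae_of_all _ fun w => ?_)
  rw [stochExp, ← Real.exp_add]
  ring_nf

lemma integral_stochExp_mul_exp (hμ : IsAbstractWienerSpace i μ) (h g : H) :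
    ∫ w, stochExp i μ h w * Real.exp (wienerIntegral i μ g w) ∂μ
      = Real.exp (⟪h, g⟫_ℝ + ‖g‖ ^ 2 / 2) := by
  have e : (fun w => stochExp i μ h w * Real.exp (wienerIntegral i μ g w)) =ᵐ[μ]
      fun w => Real.exp (-(‖h‖ ^ 2 / 2)) * Real.exp (wienerIntegral i μ (h + g) w) := by
    filter_upwards [wienerIntegral_add_ae i μ h g] with w hw
    rw [hw, stochExp, ← Real.exp_add, ← Real.exp_add]
    ring_nf
  rw [integral_congr_ae e, integral_const_mul, hμ.integral_exp, ← Real.exp_add,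
    norm_add_sq_real]
  ring_nf

lemma isProbabilityMeasure_tiltedMeasure (hμ : IsAbstractWienerSpace i μ) (h : H) :
    IsProbabilityMeasure (tiltedMeasure i μ h) := by
  refine ⟨?_⟩
  have hi := (memLp_one_iff_integrable.1 (hμ.memLp_stochExp h ENNReal.one_ne_top))
  rw [tiltedMeasure, withDensity_apply _ .univ, Measure.restrict_univ,
    ← ofReal_integral_eq_lintegral_ofReal hi (ae_of_all _ fun w => (Real.exp_pos _).le)]
  have h1 := hμ.integral_stochExp_mul_exp h 0
  have h2 : ∫ w, stochExp i μ h w * Real.exp (wienerIntegral i μ 0 w) ∂μ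
      = ∫ w, stochExp i μ h w ∂μ := by
    refine integral_congr_ae ?_
    have := wienerIntegral_smul_ae i μ 0 0
    rw [zero_smul] at this
    filter_upwards [this] with w hw
    rw [hw]; simp
  rw [h2] at h1
  simp [h1]

/-- Completing the square shows that tilting shifts the mean by `⟨h,g⟩` and keeps the variance. The
mgf is finite everywhere, hence determines the law. -/
lemma map_tiltedMeasure_wienerIntegral (hμ : IsAbstractWienerSpace i μ) (h g : H) :
    (tiltedMeasure i μ h).map (wienerIntegral i μ g) = gaussianReal ⟪h, g⟫_ℝ (‖g‖₊ ^ 2) := by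
  have := hμ.isProbabilityMeasure_tiltedMeasure h
  have hm : mgf (wienerIntegral i μ g) (tiltedMeasure i μ h)
      = mgf id (gaussianReal ⟪h, g⟫_ℝ (‖g‖₊ ^ 2)) := by
    funext t
    rw [mgf_id_gaussianReal, mgf, integral_tiltedMeasure]
    have h1 := hμ.integral_stochExp_mul_exp h (t • g)
    have h2 : ∫ w, stochExp i μ h w * Real.exp (wienerIntegral i μ (t • g) w) ∂μ
        = ∫ w, stochExp i μ h w * Real.exp (t * wienerIntegral i μ g w) ∂μ := by
      refine integral_congr_ae ?_
      filter_upwards [wienerIntegral_smul_ae i μ t g] with w hw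
      rw [hw]
    rw [← h2, h1, real_inner_smul_right, norm_smul]
    congr 1
    simp [mul_pow]
    ring
  have hY : AEMeasurable (wienerIntegral i μ g) (tiltedMeasure i μ h) :=
    (aemeasurable_wienerIntegral i μ g).mono_ac (tiltedMeasure_absolutelyContinuous i μ h)
  have hset : integrableExpSet (wienerIntegral i μ g) (tiltedMeasure i μ h) = Set.univ := by
    rw [integrableExpSet_eq_of_mgf hm, integrableExpSet_id_gaussianReal]
  have := Measure.ext_of_complexMGF_eq hY
    (aemeasurable_id (μ := gaussianReal ⟪h, g⟫_ℝ (‖g‖₊ ^ 2)))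
    (by
      funext z
      exact eqOn_complexMGF_of_mgf hm (by simp [hset]))
  rwa [Measure.map_id] at this

/-- The Cameron–Martin theorem. -/
theorem map_add_eq_tiltedMeasure (hμ : IsAbstractWienerSpace i μ) (h : H) :
    μ.map (fun w => w + i h) = tiltedMeasure i μ h := by
  have := hμ.isProbabilityMeasure
  have := hμ.isProbabilityMeasure_tiltedMeasure h
  have : IsProbabilityMeasure (μ.map (fun w => w + i h)) :=
    Measure.isProbabilityMeasure_map (by fun_prop)
  refine Measure.ext_of_charFunDual ?_
  ext φ
  rw [charFunDual_map_add_const, hμ.charFunDual_eq, charFunDual_eq_charFun_map_one,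
    ← Measure.map_congr ((tiltedMeasure_absolutelyContinuous i μ h).ae_eq
      (hμ.wienerIntegral_dualEmb φ)), hμ.map_tiltedMeasure_wienerIntegral, charFun_gaussianReal,
    ← Complex.exp_add, real_inner_comm, inner_dualEmb]
  congr 1
  push_cast
  simp
  ring

lemma measurePreserving_tiltedMeasure_neg (hμ : IsAbstractWienerSpace i μ) (h : H) :
    MeasurePreserving (fun w => w + i h) (tiltedMeasure i μ (-h)) μ := by
  refine ⟨by fun_prop, ?_⟩
  rw [← hμ.map_add_eq_tiltedMeasure, Measure.map_map (by fun_prop) (by fun_prop)]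
  convert! Measure.map_id
  ext w; simp

lemma quasiMeasurePreserving_add (hμ : IsAbstractWienerSpace i μ) (h : H) :
    Measure.QuasiMeasurePreserving (fun w => w + i h) μ μ :=
  ⟨by fun_prop, by
    rw [hμ.map_add_eq_tiltedMeasure]; exact tiltedMeasure_absolutelyContinuous i μ h⟩

/-- For `φ ∈ W*` this is linearity. In general, approximate `h` from `W*` and take an a.e.
convergent subsequence; since translation by `i m` is quasi-measure-preserving, it converges at `w`
and at `w + i m` simultaneously. -/
lemma wienerIntegral_add_shift (hμ : IsAbstractWienerSpace i μ) (h m : H) :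
    ∀ᵐ w ∂μ, wienerIntegral i μ h (w + i m) = wienerIntegral i μ h w + ⟪h, m⟫_ℝ := by
  obtain ⟨x, hx, hxh⟩ := mem_closure_iff_seq_limit.1 (denseRange_dualEmb hμ.injective h)
  choose φ hφ using hx
  have h1 : Filter.Tendsto (fun n => wienerIntegral i μ (x n)) Filter.atTop
      (nhds (wienerIntegral i μ h)) := ((wienerIntegral i μ).continuous.tendsto h).comp hxh
  obtain ⟨ns, hns, hae⟩ := (tendstoInMeasure_of_tendsto_Lp h1).exists_seq_tendsto_ae
  have h2 : ∀ᵐ w ∂μ, ∀ n, wienerIntegral i μ (x n) w = φ n w := by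
    rw [ae_all_iff]
    intro n
    rw [← hφ n]
    exact hμ.wienerIntegral_dualEmb (φ n)
  have hq := hμ.quasiMeasurePreserving_add m
  filter_upwards [h2, hae, hq.ae h2, hq.ae hae] with w a1 a2 a3 a4
  simp only [a1, a3] at a2 a4
  refine tendsto_nhds_unique a4 ?_
  have h3 : Filter.Tendsto (fun n => ⟪x (ns n), m⟫_ℝ) Filter.atTop (nhds ⟪h, m⟫_ℝ) :=
    (hxh.comp hns.tendsto_atTop).inner tendsto_const_nhds
  refine (a2.add h3).congr fun n => ?_
  rw [← hφ, inner_dualEmb, map_add]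

/-- Under the tilted measure `⟨·,g⟩` is Gaussian with mean `⟨h,g⟩`; standardizing it reduces the
claim to `integral_hermiteR_add`. In effect this computes the kernels `h^{⊗k}/k!` of `ℰ(h)`. -/
lemma integral_stochExp_mul_hermitePower (hμ : IsAbstractWienerSpace i μ) (h g : H) (k : ℕ) :
    ∫ w, stochExp i μ h w * hermitePower i μ k g w ∂μ = ⟪h, g⟫_ℝ ^ k := by
  have hY : AEMeasurable (wienerIntegral i μ g) (tiltedMeasure i μ h) :=
    (aemeasurable_wienerIntegral i μ g).mono_ac (tiltedMeasure_absolutelyContinuous i μ h)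
  set q := (Polynomial.C (‖g‖ ^ k) * (hermiteR k).comp (Polynomial.C ‖g‖⁻¹ * Polynomial.X))
  have hnn : ‖g‖₊ = ‖g‖.toNNReal := by ext; simp
  rw [← integral_tiltedMeasure]
  simp only [hermitePower_eq]
  rw [← integral_map (f := fun x => q.eval x) hY (by fun_prop),
    hμ.map_tiltedMeasure_wienerIntegral, hnn,
    integral_gaussianReal_eq_integral_affine _ _ (norm_nonneg g) (by fun_prop)]
  rcases eq_or_ne g 0 with rfl | hg
  · rcases k with _ | k <;> simp [q, hermiteR]
  · have hg' : ‖g‖ ≠ 0 := norm_ne_zero_iff.2 hg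
    have e (x : ℝ) : q.eval (‖g‖ * x + ⟪h, g⟫_ℝ)
        = ‖g‖ ^ k * (hermiteR k).eval (x + ⟪h, g⟫_ℝ / ‖g‖) := by
      simp only [q, Polynomial.eval_mul, Polynomial.eval_C, Polynomial.eval_comp, Polynomial.eval_X]
      congr 2
      field_simp
    simp_rw [e]
    rw [integral_const_mul, integral_hermiteR_add, div_pow]
    field_simp

end IsAbstractWienerSpace

end WienerChaos

end

/-! ### Orthogonality and totality of the Hermite powers -/

section

namespace WienerChaos

open scoped InnerProductSpace

lemma integrable_mul_of_memLp {α : Type*} [MeasurableSpace α] {μ : Measure α} [IsFiniteMeasure μ]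
    {v g : α → ℝ} {p : ℝ≥0∞} (hp : 1 < p) (hv : MemLp v p μ)
    (hg : ∀ q : ℝ≥0∞, q ≠ ∞ → MemLp g q μ) : Integrable (fun a => v a * g a) μ := by
  have : ENNReal.HolderConjugate p (ENNReal.conjExponent p) :=
    ENNReal.HolderConjugate.conjExponent hp.le
  refine hv.integrable_mul (q := ENNReal.conjExponent p) (hg _ ?_)
  rw [ENNReal.conjExponent]
  simp [tsub_eq_zero_iff_le, hp]

/-- Hermite polynomials are monic of every degree, so subtracting a multiple of one lowers the
degree. -/
lemma polynomial_induction_hermiteR {P : Polynomial ℝ → Prop}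
    (hz : P 0) (hadd : ∀ p q, P p → P q → P (p + q))
    (hC : ∀ (c : ℝ) n, P (Polynomial.C c * hermiteR n)) (q : Polynomial ℝ) : P q := by
  suffices h : ∀ n : ℕ, ∀ q : Polynomial ℝ, q.degree < n → P q from
    h (q.natDegree + 1) q (q.degree_le_natDegree.trans_lt (by exact_mod_cast Nat.lt_succ_self _))
  intro n
  induction n with
  | zero =>
    intro q hq
    rw [Polynomial.degree_lt_iff_coeff_zero] at hq
    rw [show q = 0 by ext m; simpa using hq m]
    exact hz
  | succ n ih =>
    intro q hq
    rw [Polynomial.degree_lt_iff_coeff_zero] at hq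
    rw [← sub_add_cancel q (Polynomial.C (q.coeff n) * hermiteR n)]
    refine hadd _ _ (ih _ ?_) (hC _ _)
    rw [Polynomial.degree_lt_iff_coeff_zero]
    intro m hm
    rcases hm.eq_or_lt with rfl | hm
    · simp [hermiteR, Polynomial.coeff_hermite_self]
    · simp [hermiteR, Polynomial.coeff_hermite_of_lt hm, hq m hm]

variable {H W : Type*} [NormedAddCommGroup H] [InnerProductSpace ℝ H] [CompleteSpace H]
  [NormedAddCommGroup W] [NormedSpace ℝ W] [MeasurableSpace W] {i : H →L[ℝ] W} {μ : Measure W}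

lemma wienerIntegral_zero_ae (i : H →L[ℝ] W) (μ : Measure W) :
    wienerIntegral i μ 0 =ᵐ[μ] 0 := by
  have := wienerIntegral_smul_ae i μ 0 0
  rw [zero_smul] at this
  filter_upwards [this] with w hw
  rw [hw]; simp

lemma hermitePower_zero_right (i : H →L[ℝ] W) (μ : Measure W) (k : ℕ) (w : W) :
    hermitePower i μ k 0 w = 0 ^ k := by
  rcases k with _ | k <;> simp [hermitePower]

lemma hermitePower_of_norm_eq_one (i : H →L[ℝ] W) (μ : Measure W) (k : ℕ) {h : H} (hh : ‖h‖ = 1)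
    (w : W) : hermitePower i μ k h w = (hermiteR k).eval (wienerIntegral i μ h w) := by
  simp [hermitePower, hh, aeval_hermite]

variable [BorelSpace W] [CompleteSpace W] [SecondCountableTopology W]

namespace IsAbstractWienerSpace

lemma integral_hermitePower_mul_hermitePower_self (hμ : IsAbstractWienerSpace i μ) {h : H}
    (hh : h ≠ 0) (k j : ℕ) :
    ∫ w, hermitePower i μ j h w * hermitePower i μ k h w ∂μ
      = if k = j then (k.factorial : ℝ) * (‖h‖ ^ 2) ^ k else 0 := by
  have hnn : ‖h‖₊ = ‖h‖.toNNReal := by ext; simp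
  simp only [hermitePower, aeval_hermite]
  rw [← integral_map (f := fun x => (‖h‖ ^ j * (hermiteR j).eval (x / ‖h‖))
      * (‖h‖ ^ k * (hermiteR k).eval (x / ‖h‖))) (aemeasurable_wienerIntegral i μ h)
      (by fun_prop), hμ.map_wienerIntegral, hnn,
    integral_gaussianReal_eq_integral_affine _ _ (norm_nonneg h) (by fun_prop)]
  have hh' : ‖h‖ ≠ 0 := norm_ne_zero_iff.2 hh
  have e (x : ℝ) : (‖h‖ ^ j * (hermiteR j).eval ((‖h‖ * x + 0) / ‖h‖))
      * (‖h‖ ^ k * (hermiteR k).eval ((‖h‖ * x + 0) / ‖h‖))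
      = ‖h‖ ^ (k + j) * ((hermiteR k).eval x * (hermiteR j).eval x) := by
    rw [add_zero, mul_div_cancel_left₀ _ hh']; ring
  simp_rw [e]
  rw [integral_const_mul, integral_hermiteR_mul_hermiteR]
  split_ifs with hkj
  · subst hkj; ring
  · simp

lemma integral_hermitePower (hμ : IsAbstractWienerSpace i μ) (k : ℕ) (h : H) :
    ∫ w, hermitePower i μ k h w ∂μ = 0 ^ k := by
  have := hμ.integral_stochExp_mul_hermitePower 0 h k
  rw [inner_zero_left] at this
  rw [← this]
  refine integral_congr_ae ?_
  filter_upwards [wienerIntegral_zero_ae i μ] with w hw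
  rw [stochExp, hw]; simp

lemma integral_hermitePower_mul_exp (hμ : IsAbstractWienerSpace i μ) (h g : H) (k : ℕ) (t : ℝ) :
    ∫ w, hermitePower i μ k g w * Real.exp (t * wienerIntegral i μ h w) ∂μ
      = Real.exp (‖t • h‖ ^ 2 / 2) * (t * ⟪h, g⟫_ℝ) ^ k := by
  rw [← real_inner_smul_left, ← hμ.integral_stochExp_mul_hermitePower, ← integral_const_mul]
  refine integral_congr_ae ?_
  filter_upwards [wienerIntegral_smul_ae i μ t h] with w hw
  rw [stochExp, hw, ← mul_assoc, ← Real.exp_add, mul_comm]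
  ring_nf

lemma integrable_hermitePower_mul_exp (hμ : IsAbstractWienerSpace i μ) (h g : H) (k : ℕ) (t : ℝ) :
    Integrable (fun w => hermitePower i μ k g w * Real.exp (t * wienerIntegral i μ h w)) μ := by
  have := hμ.isProbabilityMeasure
  refine integrable_mul_of_memLp (p := 2) (by norm_num) (hμ.memLp_hermitePower k g (by simp))
    fun q hq => ?_
  refine (hμ.memLp_exp (t • h) hq).ae_eq ?_
  filter_upwards [wienerIntegral_smul_ae i μ t h] with w hw
  rw [hw]

lemma integrable_hermitePower_mul_hermitePower (hμ : IsAbstractWienerSpace i μ) (h g : H)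
    (k j : ℕ) : Integrable (fun w => hermitePower i μ k h w * hermitePower i μ j g w) μ := by
  have := hμ.isProbabilityMeasure
  exact integrable_mul_of_memLp (p := 2) (by norm_num) (hμ.memLp_hermitePower k h (by simp))
    fun q hq => hμ.memLp_hermitePower j g hq

/-- The Hermite powers of different orders are orthogonal, and those of the same order have the
inner products of the tensor powers, up to a factor `k!`. -/
theorem integral_hermitePower_mul_hermitePower (hμ : IsAbstractWienerSpace i μ) (h g : H)
    (k j : ℕ) :
    ∫ w, hermitePower i μ j g w * hermitePower i μ k h w ∂μ
      = if k = j then (k.factorial : ℝ) * ⟪h, g⟫_ℝ ^ k else 0 := by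
  rcases eq_or_ne h 0 with rfl | hh
  · simp only [hermitePower_zero_right]
    rw [integral_mul_const, hμ.integral_hermitePower, inner_zero_left]
    rcases k with _ | k <;> rcases j with _ | j <;> simp
  have hh' : ‖h‖ ≠ 0 := norm_ne_zero_iff.2 hh
  -- With this constant, `c δ^j(h^{⊗j})` is the conditional expectation of `δ^j(g^{⊗j})` given
  -- `⟨·,h⟩`: the exponential moments along `h` are proportional to `⟨h,g⟩^j` and `‖h‖^{2j}`. The
  -- difference is therefore orthogonal to `δ^k(h^{⊗k})`, a polynomial in `⟨·,h⟩`, and only the case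
  -- `g = h` remains.
  set c : ℝ := (⟪h, g⟫_ℝ / ‖h‖ ^ 2) ^ j with hc
  have hr (t : ℝ) (w : W) : (hermitePower i μ j g w - c * hermitePower i μ j h w)
        * Real.exp (t * wienerIntegral i μ h w)
      = hermitePower i μ j g w * Real.exp (t * wienerIntegral i μ h w)
        - c * (hermitePower i μ j h w * Real.exp (t * wienerIntegral i μ h w)) := by ring
  have hr2 (w : W) : (hermitePower i μ j g w - c * hermitePower i μ j h w)
        * hermitePower i μ k h w
      = hermitePower i μ j g w * hermitePower i μ k h w
        - c * (hermitePower i μ j h w * hermitePower i μ k h w) := by ring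
  set q := (Polynomial.C (‖h‖ ^ k) * (hermiteR k).comp (Polynomial.C ‖h‖⁻¹ * Polynomial.X)) with hq
  have key := integral_mul_comp_eq_zero_of_integral_exp_eq_zero (μ := μ)
    (v := fun w => hermitePower i μ j g w - c * hermitePower i μ j h w)
    (g := fun x => q.eval x) (aemeasurable_wienerIntegral i μ h)
    (fun t => by
      simp_rw [hr]
      exact (hμ.integrable_hermitePower_mul_exp h g j t).sub
        ((hμ.integrable_hermitePower_mul_exp h h j t).const_mul c))
    (fun t => by
      simp_rw [hr]
      rw [integral_sub (hμ.integrable_hermitePower_mul_exp h g j t)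
        ((hμ.integrable_hermitePower_mul_exp h h j t).const_mul c), integral_const_mul,
        hμ.integral_hermitePower_mul_exp, hμ.integral_hermitePower_mul_exp, hc,
        real_inner_self_eq_norm_sq, div_pow, mul_pow, mul_pow]
      field_simp
      ring)
    (by fun_prop)
    (by
      simp only [hq, ← hermitePower_eq]
      simp_rw [hr2]
      exact (hμ.integrable_hermitePower_mul_hermitePower g h j k).sub
        ((hμ.integrable_hermitePower_mul_hermitePower h h j k).const_mul c))
  simp only [hq, ← hermitePower_eq] at key
  simp_rw [hr2] at key
  rw [integral_sub (hμ.integrable_hermitePower_mul_hermitePower g h j k)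
    ((hμ.integrable_hermitePower_mul_hermitePower h h j k).const_mul c), integral_const_mul,
    sub_eq_zero, hμ.integral_hermitePower_mul_hermitePower_self hh] at key
  rw [key]
  split_ifs with hkj
  · subst hkj
    rw [hc, div_pow]
    field_simp
  · simp

/-- For a unit vector `e` the Hermite powers span all polynomials in `⟨·,e⟩`. Polynomial moments
then yield exponential ones, and `t = ‖h‖` recovers `h`. -/
lemma integral_mul_exp_eq_zero (hμ : IsAbstractWienerSpace i μ) {v : W → ℝ} {p : ℝ≥0∞}
    (hp : 1 < p) (hv : MemLp v p μ)
    (h0 : ∀ (n : ℕ) (h : H), ∫ w, v w * hermitePower i μ n h w ∂μ = 0) (h : H) :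
    ∫ w, v w * Real.exp (wienerIntegral i μ h w) ∂μ = 0 := by
  have := hμ.isProbabilityMeasure
  rcases eq_or_ne h 0 with rfl | hh
  · rw [← h0 0 0]
    refine integral_congr_ae ?_
    filter_upwards [wienerIntegral_zero_ae i μ] with w hw
    rw [hw, hermitePower_zero_right]; simp
  have hh' : ‖h‖ ≠ 0 := norm_ne_zero_iff.2 hh
  set e : H := ‖h‖⁻¹ • h with he
  have hen : ‖e‖ = 1 := by rw [he, norm_smul]; simp [hh']
  have hpoly (q : Polynomial ℝ) : ∫ w, v w * q.eval (wienerIntegral i μ e w) ∂μ = 0 := by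
    induction q using polynomial_induction_hermiteR with
    | hz => simp
    | hadd p' q hp' hq =>
      simp only [Polynomial.eval_add, mul_add]
      rw [integral_add (integrable_mul_of_memLp hp hv fun r hr => hμ.memLp_eval e p' hr)
        (integrable_mul_of_memLp hp hv fun r hr => hμ.memLp_eval e q hr), hp', hq, add_zero]
    | hC c n =>
      have h1 := h0 n e
      simp only [hermitePower_of_norm_eq_one i μ n hen] at h1
      simp only [Polynomial.eval_mul, Polynomial.eval_C, mul_left_comm _ c]
      rw [integral_const_mul, h1, mul_zero]
  have hsm := wienerIntegral_smul_ae i μ ‖h‖ e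
  have hhe : ‖h‖ • e = h := by rw [he, smul_smul, mul_inv_cancel₀ hh', one_smul]
  rw [hhe] at hsm
  have := integral_exp_eq_zero_of_integral_pow_eq_zero (μ := μ) (v := v)
    (aemeasurable_wienerIntegral i μ e)
    (fun t => integrable_mul_of_memLp hp hv fun q hq => by
      refine (hμ.memLp_exp (t • e) hq).ae_eq ?_
      filter_upwards [wienerIntegral_smul_ae i μ t e] with w hw
      rw [hw])
    (fun n => by simpa using hpoly (Polynomial.X ^ n)) ‖h‖
  rw [← this]
  refine integral_congr_ae ?_
  filter_upwards [hsm] with w hw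
  rw [hw]

/-- A function in `L^p`, `p > 1`, that is orthogonal to all Hermite powers vanishes. -/
theorem ae_eq_zero_of_integral_hermitePower_eq_zero (hμ : IsAbstractWienerSpace i μ) {v : W → ℝ}
    {p : ℝ≥0∞} (hp : 1 < p) (hv : MemLp v p μ)
    (h0 : ∀ (n : ℕ) (h : H), ∫ w, v w * hermitePower i μ n h w ∂μ = 0) :
    v =ᵐ[μ] 0 := by
  have := hμ.isProbabilityMeasure
  refine ae_eq_zero_of_integral_exp_dual_eq_zero (fun φ => ?_) fun φ => ?_
  · refine integrable_mul_of_memLp hp hv fun q hq => ?_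
    refine (hμ.memLp_exp (dualEmb i φ) hq).ae_eq ?_
    filter_upwards [hμ.wienerIntegral_dualEmb φ] with w hw
    rw [hw]
  · rw [← hμ.integral_mul_exp_eq_zero hp hv h0 (dualEmb i φ)]
    refine integral_congr_ae ?_
    filter_upwards [hμ.wienerIntegral_dualEmb φ] with w hw
    rw [hw]

end IsAbstractWienerSpace

end WienerChaos

end

/-! ### Polarization and the chaos decomposition -/

section

namespace WienerChaos

open scoped InnerProductSpace

/-- Polarization: the inclusion-exclusion (Ryser) formula for the permanent. -/
lemma sum_neg_one_pow_mul_prod_sum_compl {k : ℕ} (M : Fin k → Fin k → ℝ) :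
    ∑ U : Finset (Fin k), (-1 : ℝ) ^ U.card * ∏ a, ∑ b ∈ Uᶜ, M a b
      = ∑ σ : Equiv.Perm (Fin k), ∏ a, M a (σ a) := by
  classical
  have h1 (U : Finset (Fin k)) : (-1 : ℝ) ^ U.card * ∏ a, ∑ b ∈ Uᶜ, M a b
      = ∑ f : Fin k → Fin k, if U ⊆ (Finset.univ.image f)ᶜ then
          (-1 : ℝ) ^ U.card * ∏ a, M a (f a) else 0 := by
    rw [Finset.prod_univ_sum, Finset.mul_sum, ← Finset.sum_filter]
    refine Finset.sum_congr ?_ fun _ _ => rfl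
    ext f
    simp only [Fintype.mem_piFinset, Finset.mem_compl, Finset.mem_filter, Finset.mem_univ, true_and,
      Finset.subset_iff, Finset.mem_image, not_exists]
    exact ⟨fun h x hx a ha => h a (ha ▸ hx), fun h a ha => h ha a rfl⟩
  simp_rw [h1]
  rw [Finset.sum_comm]
  -- After expanding the product over maps `f`, the alternating sum over sets `U` missed by `f`
  -- vanishes unless `f` is onto, that is, a permutation.
  have h2 (f : Fin k → Fin k) : (∑ U : Finset (Fin k), if U ⊆ (Finset.univ.image f)ᶜ then
      (-1 : ℝ) ^ U.card * ∏ a, M a (f a) else 0)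
      = if Function.Surjective f then ∏ a, M a (f a) else 0 := by
    have h3 := Finset.sum_powerset_neg_one_pow_card (x := (Finset.univ.image f)ᶜ)
    have h4 : (∑ U ∈ ((Finset.univ.image f)ᶜ).powerset, (-1 : ℝ) ^ U.card)
        = if (Finset.univ.image f)ᶜ = ∅ then 1 else 0 := by
      have := congrArg (Int.cast : ℤ → ℝ) h3
      push_cast at this
      exact this
    rw [← Finset.sum_filter, ← Finset.sum_mul]
    have h5 : Finset.univ.filter (fun U => U ⊆ (Finset.univ.image f)ᶜ)
        = ((Finset.univ.image f)ᶜ).powerset := by ext; simp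
    rw [h5, h4, ite_mul, one_mul, zero_mul]
    refine if_congr ?_ rfl rfl
    rw [Finset.compl_eq_empty_iff, ← Finset.coe_eq_univ, Finset.coe_image, Finset.coe_univ,
      Set.image_univ, Set.range_eq_univ]
  simp_rw [h2]
  refine (Finset.sum_of_injOn (fun σ : Equiv.Perm (Fin k) => (σ : Fin k → Fin k))
    (fun _ _ _ _ h => DFunLike.coe_injective h) (fun _ _ => by simp) ?_ ?_).symm
  · intro f _ hf
    rw [if_neg]
    intro hs
    exact hf ⟨Equiv.ofBijective f (Finite.injective_iff_bijective.1
      (Finite.injective_iff_surjective.2 hs)), by simp, rfl⟩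
  · intro σ _
    rw [if_pos σ.surjective]

variable {H W : Type*} [NormedAddCommGroup H] [InnerProductSpace ℝ H] [CompleteSpace H]
  [NormedAddCommGroup W] [NormedSpace ℝ W] [MeasurableSpace W] {i : H →L[ℝ] W} {μ : Measure W}
  [BorelSpace W] [CompleteSpace W] [SecondCountableTopology W]

/-- The Hermite power `δ^k(h^{⊗k})` as an element of `L²(μ)`. -/
def hermiteLp (hμ : IsAbstractWienerSpace i μ) (k : ℕ) (h : H) : Lp ℝ 2 μ :=
  (hμ.memLp_hermitePower k h (p := 2) (by simp)).toLp _

/-- The polarization of `h ↦ δ^k(h^{⊗k})`. -/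
def polarHermite (hμ : IsAbstractWienerSpace i μ) (k : ℕ) (v : Fin k → H) : Lp ℝ 2 μ :=
  (k.factorial : ℝ)⁻¹ • ∑ U : Finset (Fin k), (-1 : ℝ) ^ U.card • hermiteLp hμ k (∑ b ∈ Uᶜ, v b)

namespace IsAbstractWienerSpace

lemma coeFn_hermiteLp (hμ : IsAbstractWienerSpace i μ) (k : ℕ) (h : H) :
    hermiteLp hμ k h =ᵐ[μ] hermitePower i μ k h := MemLp.coeFn_toLp _

lemma inner_hermiteLp_right (hμ : IsAbstractWienerSpace i μ) (u : Lp ℝ 2 μ) (k : ℕ) (h : H) :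
    ⟪u, hermiteLp hμ k h⟫_ℝ = ∫ w, u w * hermitePower i μ k h w ∂μ := by
  rw [L2.inner_def]
  refine integral_congr_ae ?_
  filter_upwards [hμ.coeFn_hermiteLp k h] with w hw
  rw [hw]
  simp [mul_comm]

lemma inner_hermiteLp_hermiteLp (hμ : IsAbstractWienerSpace i μ) (k j : ℕ) (h g : H) :
    ⟪hermiteLp hμ j g, hermiteLp hμ k h⟫_ℝ
      = if k = j then (k.factorial : ℝ) * ⟪g, h⟫_ℝ ^ k else 0 := by
  rw [inner_hermiteLp_right, ← real_inner_comm, ← hμ.integral_hermitePower_mul_hermitePower]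
  refine integral_congr_ae ?_
  filter_upwards [hμ.coeFn_hermiteLp j g] with w hw
  rw [hw]

lemma chaos_eq (hμ : IsAbstractWienerSpace i μ) (k : ℕ) :
    chaos i μ k = (Submodule.span ℝ (Set.range (hermiteLp hμ k))).topologicalClosure := by
  rw [chaos]
  congr 2
  ext u
  constructor
  · rintro ⟨h, hu⟩
    exact ⟨h, Lp.ext ((hμ.coeFn_hermiteLp k h).trans hu.symm)⟩
  · rintro ⟨h, rfl⟩
    exact ⟨h, hμ.coeFn_hermiteLp k h⟩

lemma hermiteLp_mem_chaos (hμ : IsAbstractWienerSpace i μ) (k : ℕ) (h : H) :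
    hermiteLp hμ k h ∈ chaos i μ k := by
  rw [hμ.chaos_eq]
  exact Submodule.le_topologicalClosure _ (Submodule.subset_span ⟨h, rfl⟩)

lemma inner_eq_zero_of_mem_chaos (hμ : IsAbstractWienerSpace i μ) {k : ℕ} {u v : Lp ℝ 2 μ}
    (hu : u ∈ chaos i μ k) (hv : ∀ h, ⟪v, hermiteLp hμ k h⟫_ℝ = 0) : ⟪v, u⟫_ℝ = 0 := by
  rw [hμ.chaos_eq] at hu
  have h1 : Submodule.span ℝ (Set.range (hermiteLp hμ k)) ≤ (ℝ ∙ v)ᗮ := by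
    rw [Submodule.span_le]
    rintro _ ⟨h, rfl⟩
    exact Submodule.mem_orthogonal_singleton_iff_inner_right.2 (hv h)
  exact Submodule.mem_orthogonal_singleton_iff_inner_right.1
    (Submodule.topologicalClosure_minimal _ h1 (Submodule.isClosed_orthogonal _) hu)

lemma eq_of_mem_chaos (hμ : IsAbstractWienerSpace i μ) {k : ℕ} {u v : Lp ℝ 2 μ}
    (hu : u ∈ chaos i μ k) (hv : v ∈ chaos i μ k)
    (h : ∀ h, ⟪u, hermiteLp hμ k h⟫_ℝ = ⟪v, hermiteLp hμ k h⟫_ℝ) : u = v := by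
  rw [← sub_eq_zero, ← inner_self_eq_zero (𝕜 := ℝ)]
  refine hμ.inner_eq_zero_of_mem_chaos (Submodule.sub_mem _ hu hv) fun g => ?_
  rw [inner_sub_left, h, sub_self]

lemma inner_eq_zero_of_mem_chaos_of_ne (hμ : IsAbstractWienerSpace i μ) {k j : ℕ} (hkj : k ≠ j)
    {u v : Lp ℝ 2 μ} (hu : u ∈ chaos i μ k) (hv : v ∈ chaos i μ j) : ⟪u, v⟫_ℝ = 0 := by
  refine hμ.inner_eq_zero_of_mem_chaos hv fun g => ?_
  rw [real_inner_comm]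
  refine hμ.inner_eq_zero_of_mem_chaos hu fun h => ?_
  rw [hμ.inner_hermiteLp_hermiteLp, if_neg hkj]

lemma polarHermite_mem_chaos (hμ : IsAbstractWienerSpace i μ) (k : ℕ) (v : Fin k → H) :
    polarHermite hμ k v ∈ chaos i μ k :=
  Submodule.smul_mem _ _ (Submodule.sum_mem _ fun _ _ =>
    Submodule.smul_mem _ _ (hμ.hermiteLp_mem_chaos _ _))

/-- Ryser's formula for a matrix with equal rows: all `k!` permutations give the same product, which
cancels the normalization and leaves the `k!` from orthogonality. These pairings determine an
element of the chaos. -/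
lemma inner_polarHermite_hermiteLp (hμ : IsAbstractWienerSpace i μ) (k : ℕ) (v : Fin k → H)
    (g : H) : ⟪polarHermite hμ k v, hermiteLp hμ k g⟫_ℝ = (k.factorial : ℝ) * ∏ a, ⟪v a, g⟫_ℝ := by
  have h0 : (k.factorial : ℝ) ≠ 0 := by positivity
  have h1 := sum_neg_one_pow_mul_prod_sum_compl (fun _ b : Fin k => ⟪v b, g⟫_ℝ)
  have h2 (σ : Equiv.Perm (Fin k)) : ∏ a, ⟪v (σ a), g⟫_ℝ = ∏ a, ⟪v a, g⟫_ℝ :=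
    Equiv.prod_comp σ fun a => ⟪v a, g⟫_ℝ
  simp only [h2, Finset.sum_const, Finset.card_univ, Fintype.card_perm, Fintype.card_fin,
    nsmul_eq_mul, Finset.prod_const] at h1
  rw [← h1, polarHermite, real_inner_smul_left, sum_inner, inv_mul_eq_iff_eq_mul₀ h0,
    Finset.mul_sum]
  refine Finset.sum_congr rfl fun U _ => ?_
  rw [real_inner_smul_left, hμ.inner_hermiteLp_hermiteLp, if_pos rfl, sum_inner]
  ring

lemma inner_polarHermite_polarHermite (hμ : IsAbstractWienerSpace i μ) (k : ℕ) (v u : Fin k → H) :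
    ⟪polarHermite hμ k v, polarHermite hμ k u⟫_ℝ
      = ∑ σ : Equiv.Perm (Fin k), ∏ a, ⟪v a, u (σ a)⟫_ℝ := by
  have h0 : (k.factorial : ℝ) ≠ 0 := by positivity
  rw [← sum_neg_one_pow_mul_prod_sum_compl (fun a b => ⟪v a, u b⟫_ℝ)]
  conv_lhs => rw [polarHermite.eq_def hμ k u]
  rw [real_inner_smul_right, inner_sum, inv_mul_eq_iff_eq_mul₀ h0, Finset.mul_sum]
  refine Finset.sum_congr rfl fun U _ => ?_
  simp only [real_inner_smul_right, hμ.inner_polarHermite_hermiteLp, inner_sum]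
  ring

lemma polarHermite_const (hμ : IsAbstractWienerSpace i μ) (k : ℕ) (h : H) :
    polarHermite hμ k (fun _ => h) = hermiteLp hμ k h :=
  hμ.eq_of_mem_chaos (hμ.polarHermite_mem_chaos _ _) (hμ.hermiteLp_mem_chaos _ _) fun g => by
    rw [hμ.inner_polarHermite_hermiteLp, hμ.inner_hermiteLp_hermiteLp, if_pos rfl]
    simp

lemma polarHermite_comp_perm (hμ : IsAbstractWienerSpace i μ) (k : ℕ) (v : Fin k → H)
    (σ : Equiv.Perm (Fin k)) : polarHermite hμ k (v ∘ σ) = polarHermite hμ k v :=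
  hμ.eq_of_mem_chaos (hμ.polarHermite_mem_chaos _ _) (hμ.polarHermite_mem_chaos _ _) fun g => by
    rw [hμ.inner_polarHermite_hermiteLp, hμ.inner_polarHermite_hermiteLp]
    congr 1
    exact Equiv.prod_comp σ fun a => ⟪v a, g⟫_ℝ

lemma norm_polarHermite_le (hμ : IsAbstractWienerSpace i μ) (k : ℕ) (v : Fin k → H) :
    ‖polarHermite hμ k v‖ ≤ √k.factorial * ∏ a, ‖v a‖ := by
  refine le_of_sq_le_sq ?_ (by positivity)
  rw [← real_inner_self_eq_norm_sq, inner_polarHermite_polarHermite, mul_pow,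
    Real.sq_sqrt (by positivity)]
  calc _ ≤ ∑ σ : Equiv.Perm (Fin k), (∏ a, ‖v a‖) ^ 2 := by
        refine Finset.sum_le_sum fun σ _ => ?_
        refine (le_abs_self _).trans ?_
        rw [Finset.abs_prod, sq]
        conv_rhs => rw [← Equiv.prod_comp σ fun a => ‖v a‖]
        rw [Equiv.prod_comp σ fun a => ‖v a‖]
        nth_rewrite 2 [← Equiv.prod_comp σ fun a => ‖v a‖]
        rw [← Finset.prod_mul_distrib]
        exact Finset.prod_le_prod (fun _ _ => abs_nonneg _) fun a _ => abs_real_inner_le_norm _ _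
    _ = _ := by simp [Fintype.card_perm]

end IsAbstractWienerSpace

open IsAbstractWienerSpace in
/-- The polarized Hermite power as a continuous multilinear map. -/
def polarHermiteMap (hμ : IsAbstractWienerSpace i μ) (k : ℕ) : H [×k]→L[ℝ] Lp ℝ 2 μ :=
  MultilinearMap.mkContinuous
    { toFun := polarHermite hμ k
      map_update_add' := fun v a x y => by
        -- Additivity is invisible in the alternating sum; it is read off from the pairings with
        -- `hermiteLp`, which are products linear in each slot.
        refine hμ.eq_of_mem_chaos (hμ.polarHermite_mem_chaos _ _) (Submodule.add_mem _
          (hμ.polarHermite_mem_chaos _ _) (hμ.polarHermite_mem_chaos _ _)) fun g => ?_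
        rw [inner_add_left]
        simp only [hμ.inner_polarHermite_hermiteLp]
        have e (z : H) : ∏ b, ⟪Function.update v a z b, g⟫_ℝ
            = ⟪z, g⟫_ℝ * ∏ b ∈ Finset.univ.erase a, ⟪v b, g⟫_ℝ := by
          rw [← Finset.mul_prod_erase _ _ (Finset.mem_univ a), Function.update_self]
          congr 1
          exact Finset.prod_congr rfl fun b hb => by
            rw [Function.update_of_ne (Finset.ne_of_mem_erase hb)]
        rw [e, e, e, inner_add_left]
        ring
      map_update_smul' := fun v a c x => by
        refine hμ.eq_of_mem_chaos (hμ.polarHermite_mem_chaos _ _) (Submodule.smul_mem _ _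
          (hμ.polarHermite_mem_chaos _ _)) fun g => ?_
        rw [real_inner_smul_left]
        simp only [hμ.inner_polarHermite_hermiteLp]
        have e (z : H) : ∏ b, ⟪Function.update v a z b, g⟫_ℝ
            = ⟪z, g⟫_ℝ * ∏ b ∈ Finset.univ.erase a, ⟪v b, g⟫_ℝ := by
          rw [← Finset.mul_prod_erase _ _ (Finset.mem_univ a), Function.update_self]
          congr 1
          exact Finset.prod_congr rfl fun b hb => by
            rw [Function.update_of_ne (Finset.ne_of_mem_erase hb)]
        rw [e, e, real_inner_smul_left]
        ring } (√k.factorial) (hμ.norm_polarHermite_le k)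

/-- The chaos kernel of order `k` of an element of `L²(μ)`. -/
def chaosKernel (hμ : IsAbstractWienerSpace i μ) (u : Lp ℝ 2 μ) (k : ℕ) : H [×k]→L[ℝ] ℝ :=
  (k.factorial : ℝ)⁻¹ • (innerSL ℝ u).compContinuousMultilinearMap (polarHermiteMap hμ k)

namespace IsAbstractWienerSpace

lemma chaosKernel_apply (hμ : IsAbstractWienerSpace i μ) (u : Lp ℝ 2 μ) (k : ℕ) (v : Fin k → H) :
    chaosKernel hμ u k v = (k.factorial : ℝ)⁻¹ * ⟪u, polarHermite hμ k v⟫_ℝ := rfl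

/-- A Bessel argument: if `A` is the sum of squared coefficients and `G` the corresponding
combination of polarized Hermite powers, then `⟨u,G⟩ = ⟨G,G⟩ = k! A`, and Cauchy–Schwarz gives `k! A
≤ ‖u‖²`. -/
lemma isKernel_chaosKernel (hμ : IsAbstractWienerSpace i μ) (u : Lp ℝ 2 μ) (k : ℕ) :
    IsKernel (chaosKernel hμ u k) := by
  have hsymm : ∀ (σ : Equiv.Perm (Fin k)) (v : Fin k → H),
      chaosKernel hμ u k (v ∘ σ) = chaosKernel hμ u k v := fun σ v => by
    rw [chaosKernel_apply, chaosKernel_apply, polarHermite_comp_perm]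
  refine ⟨hsymm, ‖u‖ ^ 2, fun n e he => ?_⟩
  set T := chaosKernel hμ u k
  set A := ∑ s : Fin k → Fin n, T (e ∘ s) ^ 2
  have hk0 : (0 : ℝ) < k.factorial := by positivity
  have hk1 : (1 : ℝ) ≤ k.factorial := by exact_mod_cast Nat.one_le_iff_ne_zero.2 k.factorial_ne_zero
  have hA : 0 ≤ A := Finset.sum_nonneg fun _ _ => sq_nonneg _
  set G : Lp ℝ 2 μ := ∑ s : Fin k → Fin n, T (e ∘ s) • polarHermite hμ k (e ∘ s) with hG
  have h1 : ⟪u, G⟫_ℝ = k.factorial * A := by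
    rw [hG, inner_sum, Finset.mul_sum]
    refine Finset.sum_congr rfl fun s _ => ?_
    have : ⟪u, polarHermite hμ k (e ∘ s)⟫_ℝ = k.factorial * T (e ∘ s) := by
      rw [hμ.chaosKernel_apply]; field_simp
    rw [real_inner_smul_right, this]; ring
  have h2 : ⟪G, G⟫_ℝ = k.factorial * A := by
    have h3 (s : Fin k → Fin n) : ⟪polarHermite hμ k (e ∘ s), G⟫_ℝ = k.factorial * T (e ∘ s) := by
      rw [hG, inner_sum]
      simp only [real_inner_smul_right, hμ.inner_polarHermite_polarHermite, Finset.mul_sum]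
      rw [Finset.sum_comm]
      have h4 (σ : Equiv.Perm (Fin k)) : ∑ s' : Fin k → Fin n,
          T (e ∘ s') * ∏ a, ⟪(e ∘ s) a, (e ∘ s') (σ a)⟫_ℝ = T (e ∘ s) := by
        -- Orthonormality leaves only the index tuple that `σ` matches with `s`, and symmetry makes
        -- its coefficient equal to that of `s`.
        rw [Finset.sum_eq_single (s ∘ σ.symm)]
        · rw [← Function.comp_assoc, hsymm]
          simp only [Function.comp_apply, Equiv.symm_apply_apply]
          rw [Finset.prod_eq_one, mul_one]
          intro a _
          rw [real_inner_self_eq_norm_sq, he.1, one_pow]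
        · intro s' _ hs'
          obtain ⟨a, ha⟩ : ∃ a, s a ≠ s' (σ a) := by
            by_contra! hcon
            exact hs' (by ext b; simp [hcon])
          rw [Finset.prod_eq_zero (Finset.mem_univ a) (he.2 ha), mul_zero]
        · simp
      simp_rw [h4]
      simp [Fintype.card_perm]
    conv_lhs => rw [hG]
    rw [sum_inner, Finset.mul_sum]
    refine Finset.sum_congr rfl fun s _ => ?_
    rw [real_inner_smul_left, ← hG, h3]; ring
  have h5 := real_inner_mul_inner_self_le u G
  rw [h1, h2, real_inner_self_eq_norm_sq] at h5
  rcases hA.eq_or_lt with h | h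
  · rw [← h]; positivity
  · have h6 : 0 < k.factorial * A := by positivity
    have h7 := le_of_mul_le_mul_right h5 h6
    nlinarith

lemma orthogonal_iSup_chaos_eq_bot (hμ : IsAbstractWienerSpace i μ) :
    (⨆ k, chaos i μ k)ᗮ = ⊥ := by
  have := hμ.isProbabilityMeasure
  rw [Submodule.eq_bot_iff]
  intro u hu
  refine (Lp.eq_zero_iff_ae_eq_zero).2 (hμ.ae_eq_zero_of_integral_hermitePower_eq_zero (p := 2)
    (by norm_num) (Lp.memLp u) fun n h => ?_)
  rw [← hμ.inner_hermiteLp_right, real_inner_comm]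
  exact (Submodule.mem_orthogonal _ _).1 hu _
    (Submodule.mem_iSup_of_mem n (hμ.hermiteLp_mem_chaos n h))

lemma inner_hermiteLp_of_hasSum (hμ : IsAbstractWienerSpace i μ) {I : ℕ → Lp ℝ 2 μ}
    (hI : ∀ k, I k ∈ chaos i μ k) {u : Lp ℝ 2 μ} (hs : HasSum I u) (k : ℕ) (h : H) :
    ⟪I k, hermiteLp hμ k h⟫_ℝ = ⟪u, hermiteLp hμ k h⟫_ℝ := by
  rw [real_inner_comm, real_inner_comm _ u]
  refine HasSum.unique ?_ ((innerSL ℝ (hermiteLp hμ k h)).hasSum hs)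
  exact hasSum_single k fun j hj => hμ.inner_eq_zero_of_mem_chaos_of_ne hj.symm
    (hμ.hermiteLp_mem_chaos k h) (hI j)

/-- The Wiener–Itô chaos decomposition. -/
theorem hasChaosDecomposition (hμ : IsAbstractWienerSpace i μ) {f : W → ℝ} (hf : MemLp f 2 μ) :
    HasChaosDecomposition i μ f (chaosKernel hμ (hf.toLp f)) := by
  have hc (k : ℕ) : CompleteSpace (chaos i μ k) :=
    (Submodule.isClosed_topologicalClosure _).completeSpace_coe
  have hO : OrthogonalFamily ℝ (fun k => chaos i μ k) (fun k => (chaos i μ k).subtypeₗᵢ) :=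
    fun k j hkj u v => hμ.inner_eq_zero_of_mem_chaos_of_ne hkj u.2 v.2
  have hV : IsHilbertSum ℝ (fun k => chaos i μ k) (fun k => (chaos i μ k).subtypeₗᵢ) := by
    refine IsHilbertSum.mkInternal _ hO ?_
    rw [Submodule.topologicalClosure_eq_top_iff.2 hμ.orthogonal_iSup_chaos_eq_bot]
  have hs := hV.hasSum_linearIsometryEquiv_symm (hV.linearIsometryEquiv (hf.toLp f))
  rw [LinearIsometryEquiv.symm_apply_apply] at hs
  refine ⟨hf, _, fun k => ⟨hμ.isKernel_chaosKernel _ _, Subtype.coe_prop _, fun h => ?_⟩, hs⟩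
  rw [← hμ.inner_hermiteLp_right, hμ.chaosKernel_apply, hμ.polarHermite_const,
    mul_inv_cancel_left₀ (by positivity)]
  exact hμ.inner_hermiteLp_of_hasSum (fun j => Subtype.coe_prop _) hs k h

/-- Only the `k`-th term of the series pairs nontrivially. Hence the diagonal values of the kernels
depend on `f` alone, whichever decomposition is given. -/
lemma integral_mul_hermitePower_of_hasChaosDecomposition (hμ : IsAbstractWienerSpace i μ)
    {f : W → ℝ} {F : ∀ k : ℕ, H [×k]→L[ℝ] ℝ} (hF : HasChaosDecomposition i μ f F) (k : ℕ) (h : H) :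
    ∫ w, f w * hermitePower i μ k h w ∂μ = (k.factorial : ℝ) * F k (fun _ => h) := by
  obtain ⟨hf, I, hI, hs⟩ := hF
  have h1 : ∫ w, f w * hermitePower i μ k h w ∂μ = ⟪hf.toLp f, hermiteLp hμ k h⟫_ℝ := by
    rw [hμ.inner_hermiteLp_right]
    refine integral_congr_ae ?_
    filter_upwards [hf.coeFn_toLp] with w hw
    rw [hw]
  rw [h1, ← (hI k).2.integral_mul, ← hμ.inner_hermiteLp_right,
    hμ.inner_hermiteLp_of_hasSum (fun j => (hI j).2.mem_chaos) hs]

end IsAbstractWienerSpace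

end WienerChaos

end

/-! ### Wick products, translated densities and expectations -/

namespace WienerChaos

open scoped InnerProductSpace

section Tensor

variable {H : Type*} [NormedAddCommGroup H] [InnerProductSpace ℝ H]

lemma symmetrize_const {n : ℕ} (T : H [×n]→L[ℝ] ℝ) (h : H) :
    symmetrize T (fun _ => h) = T (fun _ => h) := by
  have h0 : (n.factorial : ℝ) ≠ 0 := by positivity
  simp only [symmetrize, smul_apply, sum_apply,
    ContinuousMultilinearMap.domDomCongr_apply, Finset.sum_const, Finset.card_univ,
    Fintype.card_perm, Fintype.card_fin, nsmul_eq_mul, smul_eq_mul]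
  exact inv_mul_cancel_left₀ h0 _

lemma tensor_const {k j : ℕ} (T : H [×k]→L[ℝ] ℝ) (S : H [×j]→L[ℝ] ℝ) (h : H) :
    tensor T S (fun _ => h) = T (fun _ => h) * S (fun _ => h) := by
  simp [tensor, ContinuousMultilinearMap.uncurrySum_apply, Function.comp_def]

/-- On the diagonal symmetrization has no effect and tensor products become products, so the Wick
kernel is a Cauchy product. -/
lemma wickKernel_const (F G : ∀ k : ℕ, H [×k]→L[ℝ] ℝ) (n : ℕ) (h : H) :
    wickKernel F G n (fun _ => h)
      = ∑ q ∈ Finset.HasAntidiagonal.antidiagonal n, F q.1 (fun _ => h) * G q.2 (fun _ => h) := by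
  rw [wickKernel, sum_apply,
    ← Finset.sum_attach (s := Finset.HasAntidiagonal.antidiagonal n)]
  refine Finset.sum_congr rfl fun q _ => ?_
  rw [← tensor_const, ← symmetrize_const (tensor _ _)]
  rfl

end Tensor

variable {H W : Type*} [NormedAddCommGroup H] [InnerProductSpace ℝ H] [CompleteSpace H]
  [NormedAddCommGroup W] [NormedSpace ℝ W] [MeasurableSpace W] {i : H →L[ℝ] W} {μ : Measure W}

/-- The density of the law of `X - i m` with respect to `μ`, when `X` has density `f`. -/
def shiftedDensity (i : H →L[ℝ] W) (μ : Measure W) (f : W → ℝ) (m : H) (w : W) : ℝ :=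
  f (w + i m) * stochExp i μ (-m) w

/-- The translate of a Hermite power expands in the Hermite powers of lower order. -/
lemma hermitePower_translate (i : H →L[ℝ] W) (μ : Measure W) (n : ℕ) (h : H) (w : W) (c : ℝ)
    (hc : h = 0 → c = 0) :
    ‖h‖ ^ n * (hermiteR n).eval ((wienerIntegral i μ h w + c) / ‖h‖)
      = ∑ q ∈ Finset.HasAntidiagonal.antidiagonal n,
        (n.choose q.1 : ℝ) * hermitePower i μ q.1 h w * c ^ q.2 := by
  have hexp := hermiteR_eval_add n (wienerIntegral i μ h w / ‖h‖) (c / ‖h‖)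
  rw [add_div, hexp, Finset.mul_sum]
  refine Finset.sum_congr rfl fun q hq => ?_
  rw [hermitePower, aeval_hermite, ← Finset.HasAntidiagonal.mem_antidiagonal.1 hq, pow_add, div_pow]
  -- At `h = 0` the left side is `0` for `n > 0`, while the `q.1 = 0` term on the right is `c ^ n`;
  -- this is why `hc` is needed.
  rcases eq_or_ne h 0 with rfl | hh
  · rw [hc rfl]
    rcases q with ⟨a, _ | b⟩ <;> simp
  · have : ‖h‖ ≠ 0 := norm_ne_zero_iff.2 hh
    field_simp

lemma integral_mul_wienerIntegral {f : W → ℝ} (hf : MemLp f 2 μ) (h : H) :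
    ∫ w, f w * wienerIntegral i μ h w ∂μ
      = ⟪(wienerIntegral i μ).adjoint (hf.toLp f), h⟫_ℝ := by
  rw [ContinuousLinearMap.adjoint_inner_left, L2.inner_def]
  refine integral_congr_ae ?_
  filter_upwards [hf.coeFn_toLp] with w hw
  rw [hw]
  simp [mul_comm]

lemma HasDensity.congr {Ω : Type*} [MeasurableSpace Ω] {W : Type*}
    [MeasurableSpace W] {μ : Measure W} {P : Measure Ω} {Y : Ω → W} {u v : W → ℝ}
    (hu : HasDensity P Y μ u) (huv : u =ᵐ[μ] v) : HasDensity P Y μ v := by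
  refine ⟨hu.1.trans huv.le, hu.2.1.congr huv, ?_⟩
  rw [← withDensity_congr_ae (f := fun w => ENNReal.ofReal (u w))]
  · exact hu.2.2
  · filter_upwards [huv] with w hw
    rw [hw]

variable [BorelSpace W]

lemma measurableEmbedding_add_const {W : Type*} [NormedAddCommGroup W] [MeasurableSpace W]
    [BorelSpace W] (x : W) :
    MeasurableEmbedding (fun w : W => w + x) := (Homeomorph.addRight x).measurableEmbedding

variable [CompleteSpace W] [SecondCountableTopology W]

namespace IsAbstractWienerSpace

lemma integral_stochExp_neg_mul_comp_add (hμ : IsAbstractWienerSpace i μ) (m : H) (g : W → ℝ) :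
    ∫ w, stochExp i μ (-m) w * g (w + i m) ∂μ = ∫ w, g w ∂μ := by
  rw [← integral_tiltedMeasure i μ (-m) (fun w => g (w + i m))]
  exact (hμ.measurePreserving_tiltedMeasure_neg m).integral_comp (measurableEmbedding_add_const _) g

lemma aestronglyMeasurable_comp_add (hμ : IsAbstractWienerSpace i μ) (m : H) {f : W → ℝ}
    (hf : AEStronglyMeasurable f μ) : AEStronglyMeasurable (fun w => f (w + i m)) μ :=
  hf.comp_quasiMeasurePreserving (hμ.quasiMeasurePreserving_add m)

/-- Split `ℰ(-m)` into two square roots. By Cameron–Martin `f(· + i m) √ℰ(-m)` is in `L²`, and the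
remaining root is in `L⁴`, so Hölder gives `p = (1/2 + 1/4)⁻¹ = 4/3`. -/
lemma memLp_shiftedDensity (hμ : IsAbstractWienerSpace i μ) {f : W → ℝ} (hf : MemLp f 2 μ)
    (m : H) : ∃ p : ℝ≥0∞, 1 < p ∧ MemLp (shiftedDensity i μ f m) p μ := by
  have hfm := hμ.aestronglyMeasurable_comp_add m hf.1
  have hsm := aemeasurable_stochExp i μ (-m)
  have hsq (w : W) : √(stochExp i μ (-m) w) * √(stochExp i μ (-m) w) = stochExp i μ (-m) w :=
    Real.mul_self_sqrt (stochExp_pos i μ (-m) w).le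
  have h1 : MemLp (fun w => f (w + i m) * √(stochExp i μ (-m) w)) 2 μ := by
    refine (memLp_two_iff_integrable_sq (hfm.mul hsm.sqrt.aestronglyMeasurable)).2 ?_
    have h2 := (hf.comp_measurePreserving (hμ.measurePreserving_tiltedMeasure_neg m)).integrable_sq
    rw [tiltedMeasure, integrable_withDensity_iff_integrable_smul₀' hsm.ennreal_ofReal
      (by simp)] at h2
    refine h2.congr (ae_of_all _ fun w => ?_)
    simp only [smul_eq_mul, Function.comp_apply, Pi.mul_apply, mul_pow]
    rw [ENNReal.toReal_ofReal (stochExp_pos i μ (-m) w).le, sq √_, hsq, mul_comm]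
  have h3 : MemLp (fun w => √(stochExp i μ (-m) w)) 4 μ := by
    refine ((hμ.memLp_exp (p := 4) ((1 / 2 : ℝ) • (-m)) (by simp)).const_mul
      (Real.exp (-(‖(-m)‖ ^ 2 / 4)))).ae_eq ?_
    filter_upwards [wienerIntegral_smul_ae i μ (1 / 2) (-m)] with w hw
    rw [hw, ← Real.exp_add, stochExp, Real.sqrt_eq_rpow, ← Real.exp_mul]
    ring_nf
  have : ENNReal.HolderTriple 2 4 ((2⁻¹ + 4⁻¹)⁻¹) := ⟨(inv_inv _).symm⟩
  refine ⟨(2⁻¹ + 4⁻¹)⁻¹, ?_, (h3.mul' h1).ae_eq (ae_of_all _ fun w => ?_)⟩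
  · rw [ENNReal.one_lt_inv, ← ENNReal.inv_two_add_inv_two]
    exact ENNReal.add_lt_add_left (by simp) (ENNReal.inv_lt_inv.2 (by norm_num))
  · rw [mul_assoc, hsq, shiftedDensity]

lemma integral_shiftedDensity_mul_hermitePower (hμ : IsAbstractWienerSpace i μ) {f : W → ℝ}
    {F G : ∀ k : ℕ, H [×k]→L[ℝ] ℝ} {m : H} (hF : HasChaosDecomposition i μ f F)
    (hG : HasChaosDecomposition i μ (stochExp i μ (-m)) G) (n : ℕ) (h : H) :
    ∫ w, shiftedDensity i μ f m w * hermitePower i μ n h w ∂μ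
      = (n.factorial : ℝ) * wickKernel F G n (fun _ => h) := by
  have hf : MemLp f 2 μ := hF.1
  have := hμ.isProbabilityMeasure
  -- The powers of the shift in the binomial expansion are thus the kernels of `ℰ(-m)`, and the
  -- binomial coefficients absorb the factorials.
  have hGv (j : ℕ) : (j.factorial : ℝ) * G j (fun _ => h) = (-⟪h, m⟫_ℝ) ^ j := by
    rw [← hμ.integral_mul_hermitePower_of_hasChaosDecomposition hG,
      hμ.integral_stochExp_mul_hermitePower, inner_neg_left, real_inner_comm]
  have h1 : ∫ w, shiftedDensity i μ f m w * hermitePower i μ n h w ∂μ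
      = ∫ w, stochExp i μ (-m) w * (fun w' => f w' *
        (‖h‖ ^ n * (hermiteR n).eval ((wienerIntegral i μ h w' + -⟪h, m⟫_ℝ) / ‖h‖))) (w + i m) ∂μ := by
    refine integral_congr_ae ?_
    filter_upwards [hμ.wienerIntegral_add_shift h m] with w hw
    simp only [hw]
    rw [shiftedDensity, hermitePower, aeval_hermite, add_neg_cancel_right]
    ring
  rw [h1, hμ.integral_stochExp_neg_mul_comp_add m (fun w' => f w' *
    (‖h‖ ^ n * (hermiteR n).eval ((wienerIntegral i μ h w' + -⟪h, m⟫_ℝ) / ‖h‖)))]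
  have h2 (w : W) : f w * (‖h‖ ^ n *
        (hermiteR n).eval ((wienerIntegral i μ h w + -⟪h, m⟫_ℝ) / ‖h‖))
      = ∑ q ∈ Finset.HasAntidiagonal.antidiagonal n,
        ((n.choose q.1 : ℝ) * (-⟪h, m⟫_ℝ) ^ q.2) * (f w * hermitePower i μ q.1 h w) := by
    rw [hermitePower_translate i μ n h w _ (by rintro rfl; simp), Finset.mul_sum]
    exact Finset.sum_congr rfl fun q _ => by ring
  simp_rw [h2]
  rw [integral_finsetSum _ fun q _ => (integrable_mul_of_memLp (p := 2) (by norm_num) hf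
    fun r hr => hμ.memLp_hermitePower q.1 h hr).const_mul _, wickKernel_const, Finset.mul_sum]
  refine Finset.sum_congr rfl fun q hq => ?_
  rw [integral_const_mul, hμ.integral_mul_hermitePower_of_hasChaosDecomposition hF, ← hGv,
    ← Finset.HasAntidiagonal.mem_antidiagonal.1 hq,
    ← Nat.add_choose_mul_factorial_mul_factorial q.1 q.2, Nat.choose_symm_add]
  push_cast
  ring

lemma hasDensity_shiftedDensity (hμ : IsAbstractWienerSpace i μ) {Ω : Type*} [MeasurableSpace Ω]
    {P : Measure Ω} {X : Ω → W} {f : W → ℝ} (hX : HasDensity P X μ f) (m : H) :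
    HasDensity P (fun ω => X ω - i m) μ (shiftedDensity i μ f m) := by
  obtain ⟨h0, hfm, hlaw⟩ := hX
  have hsm := aemeasurable_stochExp i μ (-m)
  have hfs : AEMeasurable (fun w => f (w + i m)) μ :=
    hfm.comp_quasiMeasurePreserving (hμ.quasiMeasurePreserving_add m)
  have hd : AEMeasurable (shiftedDensity i μ f m) μ := hfs.mul hsm
  refine ⟨?_, hd, ?_⟩
  · filter_upwards [(hμ.quasiMeasurePreserving_add m).ae h0] with w hw
    exact mul_nonneg hw (stochExp_pos i μ (-m) w).le
  refine HasLaw.fun_comp (Y := fun w => w - i m) ⟨by fun_prop, ?_⟩ hlaw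
  -- Both sides are tested on nonnegative `g`, and `μ` is replaced by the image of the tilted
  -- measure under `w ↦ w + i m`.
  refine Measure.ext_of_lintegral _ fun g hg => ?_
  have hfe : AEMeasurable (fun w => ENNReal.ofReal (f w)) μ := hfm.ennreal_ofReal
  have hfse : AEMeasurable (fun w => ENNReal.ofReal (f (w + i m)) * g w) μ :=
    hfs.ennreal_ofReal.mul hg.aemeasurable
  have hgs : AEMeasurable (fun w => g (w - i m)) μ :=
    (hg.comp (measurable_sub_const (i m))).aemeasurable
  rw [lintegral_map hg (measurable_sub_const (i m)),
    lintegral_withDensity_eq_lintegral_mul₀ hfe hgs,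
    ← (hμ.measurePreserving_tiltedMeasure_neg m).lintegral_comp_emb
      (measurableEmbedding_add_const _)]
  simp only [Pi.mul_apply, add_sub_cancel_right]
  rw [tiltedMeasure, lintegral_withDensity_eq_lintegral_mul₀ hsm.ennreal_ofReal hfse,
    lintegral_withDensity_eq_lintegral_mul₀ hd.ennreal_ofReal hg.aemeasurable]
  refine lintegral_congr fun w => ?_
  simp only [Pi.mul_apply, shiftedDensity]
  rw [ENNReal.ofReal_mul' (stochExp_pos i μ (-m) w).le]
  ring

lemma isExpectation (hμ : IsAbstractWienerSpace i μ) {Ω : Type*} [MeasurableSpace Ω]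
    {P : Measure Ω} {X : Ω → W} {f : W → ℝ} (hf : MemLp f 2 μ) (hX : HasDensity P X μ f) :
    IsExpectation P X (i ((wienerIntegral i μ).adjoint (hf.toLp f))) := by
  obtain ⟨h0, hfm, hlaw⟩ := hX
  have := hμ.isProbabilityMeasure
  intro φ
  have hφ : Integrable (fun w => f w * φ w) μ := by
    refine hf.integrable_mul (q := 2) ((hμ.memLp_id).continuousLinearMap_comp φ)
  have h1 : Integrable φ (P.map X) := by
    rw [hlaw.map_eq]
    exact integrable_withDensity_ofReal hfm (by fun_prop) hφ
  refine ⟨h1.comp_aemeasurable hlaw.aemeasurable, ?_⟩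
  have h2 := hlaw.integral_comp (f := φ) (by fun_prop)
  rw [Function.comp_def] at h2
  rw [h2, integral_withDensity_ofReal hfm, ← inner_dualEmb, real_inner_comm,
    ← integral_mul_wienerIntegral]
  refine integral_congr_ae ?_
  filter_upwards [h0, hμ.wienerIntegral_dualEmb φ] with w hw hw2
  rw [hw2, max_eq_left (by simpa using hw)]

lemma firstKernel_eq (hμ : IsAbstractWienerSpace i μ) {f : W → ℝ} (hf : MemLp f 2 μ)
    {F : ∀ k : ℕ, H [×k]→L[ℝ] ℝ} (hF : HasChaosDecomposition i μ f F) (h : H) :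
    F 1 (fun _ => h) = ⟪(wienerIntegral i μ).adjoint (hf.toLp f), h⟫_ℝ := by
  have h1 := hμ.integral_mul_hermitePower_of_hasChaosDecomposition hF 1 h
  rw [Nat.factorial_one, Nat.cast_one, one_mul] at h1
  rw [← h1, ← integral_mul_wienerIntegral]
  refine integral_congr_ae ?_
  rcases eq_or_ne h 0 with rfl | hh
  · filter_upwards [wienerIntegral_zero_ae i μ] with w hw
    rw [hw, hermitePower_zero_right]; simp
  · refine ae_of_all _ fun w => ?_
    have : ‖h‖ ≠ 0 := norm_ne_zero_iff.2 hh
    simp only [hermitePower, Polynomial.hermite_one, Polynomial.aeval_X, pow_one]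
    field_simp

/-- Two exponents are allowed because each Wick product comes with its own `p`; the difference lies
in `L^{min p q}`. -/
lemma ae_eq_of_hasGeneralizedChaosExpansion (hμ : IsAbstractWienerSpace i μ) {u v : W → ℝ}
    {p q : ℝ≥0∞} (hp : 1 < p) (hq : 1 < q) (hu : MemLp u p μ) (hv : MemLp v q μ)
    (h : ∀ (n : ℕ) (h : H), ∫ w, u w * hermitePower i μ n h w ∂μ
      = ∫ w, v w * hermitePower i μ n h w ∂μ) : u =ᵐ[μ] v := by
  have := hμ.isProbabilityMeasure
  have h1 := hμ.ae_eq_zero_of_integral_hermitePower_eq_zero (v := fun w => u w - v w)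
    (lt_min hp hq) ((hu.mono_exponent (min_le_left p q)).sub (hv.mono_exponent (min_le_right p q)))
    fun n g => by
      simp only [sub_mul]
      rw [integral_sub (integrable_mul_of_memLp hp hu fun r hr => hμ.memLp_hermitePower n g hr)
        (integrable_mul_of_memLp hq hv fun r hr => hμ.memLp_hermitePower n g hr), h, sub_self]
  filter_upwards [h1] with w hw
  exact sub_eq_zero.1 hw

end IsAbstractWienerSpace

end WienerChaos

end

theorem proposition3p1 {H W Ω : Type*}
    [NormedAddCommGroup H] [InnerProductSpace ℝ H] [CompleteSpace H]
    [TopologicalSpace.SeparableSpace H]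
    [NormedAddCommGroup W] [NormedSpace ℝ W] [CompleteSpace W] [MeasurableSpace W] [BorelSpace W]
    (i : H →L[ℝ] W) (μ : Measure W) (hμ : WienerChaos.IsAbstractWienerSpace i μ)
    [MeasurableSpace Ω] (P : Measure Ω) [IsProbabilityMeasure P]
    (X : Ω → W) (f : W → ℝ) (hf : MemLp f 2 μ) (hX : WienerChaos.HasDensity P X μ f) :
    ∃ m : H,
      -- the expectation of `X` exists in `W` and is the element `m` of the Cameron-Martin space
      WienerChaos.IsExpectation P X (i m) ∧
      -- `f` has a chaos decomposition, and its first kernel is `m`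
      (∃ F, WienerChaos.HasChaosDecomposition i μ f F) ∧
      (∀ F, WienerChaos.HasChaosDecomposition i μ f F → ∀ h : H, F 1 (fun _ => h) = inner ℝ m h) ∧
      -- the Wick product of `f` with the stochastic exponential of `-m` exists,
      -- and it is the density of `X - E[X]`
      (∃ u, WienerChaos.IsWickProduct i μ f (WienerChaos.stochExp i μ (-m)) u) ∧
      (∀ u, WienerChaos.IsWickProduct i μ f (WienerChaos.stochExp i μ (-m)) u →
        WienerChaos.HasDensity P (fun ω => X ω - i m) μ u) := by
  have : TopologicalSpace.SeparableSpace W := hμ.denseRange.separableSpace i.continuous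
  have : SecondCountableTopology W := UniformSpace.secondCountable_of_separable W
  -- The adjoint supplies the Riesz representative of `h ↦ ∫ f ⟨·,h⟩ dμ`.
  set m := (WienerChaos.wienerIntegral i μ).adjoint (hf.toLp f)
  obtain ⟨p, hp, hup⟩ := hμ.memLp_shiftedDensity hf m
  have hF := hμ.hasChaosDecomposition hf
  have hG := hμ.hasChaosDecomposition (hμ.memLp_stochExp (-m) (p := 2) (by simp))
  refine ⟨m, hμ.isExpectation hf hX, ⟨_, hF⟩, fun F hF h => hμ.firstKernel_eq hf hF h,
    ⟨WienerChaos.shiftedDensity i μ f m, _, _, hF, hG, ⟨p, hp, hup⟩,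
      hμ.integral_shiftedDensity_mul_hermitePower hF hG⟩, ?_⟩
  rintro u ⟨F, G, hF, hG, ⟨q, hq, huq⟩, hu⟩
  refine (hμ.hasDensity_shiftedDensity hX m).congr ?_
  -- The kernels `F` and `G` here are arbitrary, but the pairing formula holds for every choice, so
  -- `u` has the same pairings as the translated density.
  refine hμ.ae_eq_of_hasGeneralizedChaosExpansion hp hq hup huq fun n h => ?_
  rw [hu, hμ.integral_shiftedDensity_mul_hermitePower hF hG]
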